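/- Let $(R,\mathfrak m,k)$ be a commutative Noetherian local ring, with Krull dimension $\dim R$. For an $R$-module $X$ (not necessarily finitely generated) put $\operatorname{depth}_R X=\inf\{i\ge 0:\operatorname{Ext}^i_R(k,X)\neq 0\}\in\mathbb N\cup\{\infty\}$. A nonzero finitely generated $R$-module $M$ is Cohen–Macaulay if $\operatorname{depth}_R M=\dim_R M$, and $R$ is Cohen–Macaulay if it is so as a module over itself. An $R$-module $B$ is big Cohen–Macaulay if some system of parameters $x=x_1,\dots,x_n$ of $R$ (that is, $n=\dim R$ and $\sqrt{(x)}=\mathfrak m$) is a $B$-regular sequence (in particular $B\neq (x)B$). A finitely generated $R$-module $T$ is totally reflexive if there is an exact complex $F$, indexed by $\mathbb Z$, of finitely generated free $R$-modules such that $T\cong\operatorname{im}(F_0\to F_{-1})$ and $\operatorname{Hom}_R(F,R)$ is exact. The G-dimension of a finitely generated $R$-module $M$ is the infimum of $\sup\{l\in\mathbb Z: Q_l\neq 0\}$ over all complexes $Q$ of totally reflexive $R$-modules with $Q_l=0$ for $l\ll 0$ that are isomorphic to $M$ in the derived category of $R$. **Theorem 4.3.** Assume that there exists a nonzero Cohen–Macaulay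 $R$-module $M$ of finite G-dimension. Then the following are equivalent: (i) $R$ is a Cohen–Macaulay ring. (ii) There exists a big Cohen–Macaulay $R$-module $B$ such that $\operatorname{Tor}_1^R(B,T)=0$ for all totally reflexive $R$-modules $T$. (iii) There exists an $R$-module $B$ such that $\operatorname{depth}_R B<\infty$ and $\operatorname{depth}_R(B\otimes_R T)\ge \dim R$ for all totally reflexive $R$-modules $T$. -/

import Mathlib

open CategoryTheory IsLocalRing TensorProduct

universe u

noncomputable section

namespace LocalAlgebra

variable (R : Type u) [CommRing R]

/-- `depth_R M = inf {i | Ext^i_R(k, M) ≠ 0}`, where `k` is the residue field; it is `⊤` when all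
these Ext modules vanish. `M` is not assumed to be finitely generated. -/
def depth [IsLocalRing R] (M : ModuleCat.{u} R) : ℕ∞ :=
  ⨅ i ∈ {i : ℕ | Nontrivial (Abelian.Ext.{u} (ModuleCat.of R (ResidueField R)) M i)}, (i : ℕ∞)

/-- A Cohen–Macaulay module: finitely generated, and zero or of depth equal to its dimension. -/
def IsCohenMacaulayModule [IsLocalRing R] (M : ModuleCat.{u} R) : Prop :=
  Module.Finite R M ∧
    (Subsingleton M ∨ (depth R M : WithBot ℕ∞) = Module.supportDim R M)

/-- A local ring is Cohen–Macaulay if it is so as a module over itself. -/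
def IsCohenMacaulayLocalRing [IsLocalRing R] : Prop :=
  IsCohenMacaulayModule R (ModuleCat.of R R)

/-- A system of parameters: `dim R` elements that generate an ideal primary to the
maximal ideal. -/
def IsSystemOfParameters [IsLocalRing R] (x : List R) : Prop :=
  (x.length : WithBot ℕ∞) = ringKrullDim R ∧ (Ideal.ofList x).radical = maximalIdeal R

/-- A big Cohen–Macaulay module: some system of parameters is a regular sequence on it
(in particular `B ≠ (x) B`). -/
def IsBigCohenMacaulay [IsLocalRing R] (B : ModuleCat.{u} R) : Prop :=
  ∃ x : List R, IsSystemOfParameters R x ∧ RingTheory.Sequence.IsRegular B x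

/-- A totally reflexive module: `M` is finitely generated and there is an exact complex `F` of
finitely generated free modules, indexed by `ℤ`, such that `M ≅ im (F_0 → F_{-1})` and
`Hom_R(F, R)` is exact. -/
def IsTotallyReflexive (M : ModuleCat.{u} R) : Prop :=
  Module.Finite R M ∧ ∃ F : ChainComplex (ModuleCat.{u} R) ℤ,
    (∀ n, Module.Free R (F.X n) ∧ Module.Finite R (F.X n)) ∧
    (∀ n, Function.Exact (F.d (n + 1) n).hom (F.d n (n - 1)).hom) ∧
    (∀ n, Function.Exact (LinearMap.lcomp R R (F.d n (n - 1)).hom)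
      (LinearMap.lcomp R R (F.d (n + 1) n).hom)) ∧
    Nonempty (M ≃ₗ[R] LinearMap.range (F.d 0 (-1)).hom)

/-- `Q` and the module `M`, placed in degree zero, are isomorphic in the derived category. -/
def IsoInDerivedCategory (Q : CochainComplex (ModuleCat.{u} R) ℤ) (M : ModuleCat.{u} R) : Prop :=
  letI : HasDerivedCategory (ModuleCat.{u} R) := HasDerivedCategory.standard _
  Nonempty (DerivedCategory.Q.obj Q ≅ (DerivedCategory.singleFunctor (ModuleCat.{u} R) 0).obj M)

/-- The G-dimension of a module: the infimum of `sup {l | Q_l ≠ 0}` over all complexes `Q` of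
totally reflexive modules that are bounded to the right (`Q_l = 0` for `l ≪ 0`) and isomorphic
to `M` in the derived category. Homological degree `l` is cohomological degree `-l`, so
`Q_l = Q.X (-l)`, and bounded to the right means `Q.X n = 0` for `n ≫ 0`.
The value is `⊤` if no such `Q` is bounded. -/
def gDim (M : ModuleCat.{u} R) : WithBot (WithTop ℤ) :=
  ⨅ Q ∈ {Q : CochainComplex (ModuleCat.{u} R) ℤ | (∀ n, IsTotallyReflexive R (Q.X n)) ∧
      (∃ n : ℤ, Q.IsStrictlyLE n) ∧ IsoInDerivedCategory R Q M},
    ⨆ l ∈ {l : ℤ | ¬ Limits.IsZero (Q.X (-l))}, ((l : WithTop ℤ) : WithBot (WithTop ℤ))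

end LocalAlgebra

end

/-! The substance is (iii) ⇒ (i). Cutting the Cohen–Macaulay module down by a regular sequence of
length its dimension gives a nonzero finite module `M`, still of finite G-dimension, killed by a
power of `𝔪`. If `M` has a totally reflexive `g`-th syzygy, the module `B` of (iii) forces `dim R ≤
g`, while the Auslander–Bridger argument provides such a `g ≤ depth R`. Hence `depth R ≥ dim R`.

The lower bound (`GDimLE.le_of_subsingleton_residueExt_tensor`) is an intersection theorem. Tensor
the syzygy sequences of `M` with `B`. Since a power of `𝔪` kills `M`, it kills every `Tor_1` of `B`
with a syzygy; that `Tor_1` sits in a module of positive depth, so it vanishes and the sequences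
stay exact. Each sequence costs one unit of depth, so `g < dim R` would give `B ⊗ M` positive depth.
Being killed by a power of `𝔪`, it would be zero, and then `B = 𝔪B`. This is excluded by
`subsingleton_residueExt_of_smul_top_eq_top`, a Koszul argument in the derived category: `B = 𝔪B`
and `depth B ≥ dim R` would make `depth B` infinite.

The upper bound (`GDimLE.exists_add_eq_depth`) rests on the behaviour of `Ext^r(k, T)` for `T`
totally reflexive and `r = depth R`: a functional on `T` that does not extend is detected by a class
in this module.

For (i) ⇒ (ii) take `B = R`. For (ii) ⇒ (iii), `T` has cosyzygies of every order, and
`Tor_1`-vanishing keeps their sequences exact after tensoring with `B`, so `B ⊗ T` inherits the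
depth of `B`.

Total reflexivity is handled through one-step syzygies, one-step cosyzygies and the vanishing of
`Ext¹(-, R)`; the complex over `ℤ` is assembled only in `isTotallyReflexive_of_class`. -/

noncomputable section

namespace LocalAlgebra

/-! ### Short exact sequences and syzygies -/

section Syzygy

variable {R : Type u} [CommRing R]
variable {A B C D : Type u} [AddCommGroup A] [Module R A] [AddCommGroup B] [Module R B]
  [AddCommGroup C] [Module R C] [AddCommGroup D] [Module R D]

/-- `0 → A → B → C → 0` is exact. -/
structure IsShortExact (f : A →ₗ[R] B) (g : B →ₗ[R] C) : Prop where
  injective : Function.Injective f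
  exact : Function.Exact f g
  surjective : Function.Surjective g

theorem exists_comp_eq_of_surjective {p : A →ₗ[R] B} (hp : Function.Surjective p)
    (q : A →ₗ[R] C) (h : ∀ a, p a = 0 → q a = 0) : ∃ s : B →ₗ[R] C, ∀ a, s (p a) = q a := by
  refine ⟨((LinearMap.ker p).liftQ q fun a ha => h a ha) ∘ₗ
    (p.quotKerEquivOfSurjective hp).symm.toLinearMap, fun a => ?_⟩
  have : (p.quotKerEquivOfSurjective hp).symm (p a) = Submodule.Quotient.mk a := by
    rw [LinearEquiv.symm_apply_eq]; rfl
  rw [LinearMap.comp_apply, LinearEquiv.coe_coe, this]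
  rfl

theorem exists_comp_eq_of_injective {i : B →ₗ[R] C} (hi : Function.Injective i)
    (q : A →ₗ[R] C) (h : ∀ a, ∃ b, i b = q a) : ∃ s : A →ₗ[R] B, ∀ a, i (s a) = q a := by
  refine ⟨(LinearEquiv.ofInjective i hi).symm.toLinearMap ∘ₗ
    q.codRestrict (LinearMap.range i) (fun a => h a), fun a => ?_⟩
  exact congrArg Subtype.val
    ((LinearEquiv.ofInjective i hi).apply_symm_apply
      (q.codRestrict (LinearMap.range i) (fun a => h a) a))

theorem IsShortExact.comp_apply {f : A →ₗ[R] B} {g : B →ₗ[R] C} (h : IsShortExact f g) (a : A) :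
    g (f a) = 0 := h.exact.apply_apply_eq_zero a

theorem isShortExact_ker {g : B →ₗ[R] C} (hg : Function.Surjective g) :
    IsShortExact (LinearMap.ker g).subtype g :=
  ⟨Subtype.val_injective, fun b => by simp, hg⟩

theorem isShortExact_mkQ {f : A →ₗ[R] B} (hf : Function.Injective f) :
    IsShortExact f (LinearMap.range f).mkQ :=
  ⟨hf, fun b => by simp, Submodule.mkQ_surjective _⟩

variable (R) in
/-- `K` is a syzygy of `M`: there is an exact sequence `0 → K → R^m → M → 0`. -/
def IsSyzygy (K M : Type u) [AddCommGroup K] [Module R K] [AddCommGroup M] [Module R M] : Prop :=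
  ∃ (m : ℕ) (i : K →ₗ[R] (Fin m → R)) (p : (Fin m → R) →ₗ[R] M), IsShortExact i p

theorem IsShortExact.isSyzygy [Module.Free R B] [Module.Finite R B] {f : A →ₗ[R] B}
    {g : B →ₗ[R] C} (h : IsShortExact f g) : IsSyzygy R A C := by
  let e := ((Module.Free.chooseBasis R B).reindex (Fintype.equivFin _)).equivFun
  refine ⟨_, e.toLinearMap ∘ₗ f, g ∘ₗ e.symm.toLinearMap, ⟨e.injective.comp h.injective, fun b => ?_,
    h.surjective.comp e.symm.surjective⟩⟩
  constructor
  · intro hb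
    obtain ⟨a, ha⟩ := (h.exact _).1 hb
    exact ⟨a, by simp [ha]⟩
  · rintro ⟨a, rfl⟩
    simp [h.comp_apply]

theorem IsSyzygy.finite {K M : Type u} [AddCommGroup K] [Module R K] [AddCommGroup M] [Module R M]
    (h : IsSyzygy R K M) : Module.Finite R M := by
  obtain ⟨m, i, p, h⟩ := h
  exact Module.Finite.of_surjective p h.surjective

variable (R) in
/-- `Ext¹(T, R) = 0`, in the form: functionals on the kernel of a surjection onto `T` extend. -/
def HasTrivialExtOne (T : Type u) [AddCommGroup T] [Module R T] : Prop :=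
  ∀ (N : Type u) [AddCommGroup N] [Module R N] (f : N →ₗ[R] T), Function.Surjective f →
    ∀ φ : LinearMap.ker f →ₗ[R] R, ∃ ψ : N →ₗ[R] R, ∀ x : LinearMap.ker f, ψ x = φ x

theorem HasTrivialExtOne.exists_extension (hC : HasTrivialExtOne R C) {f : A →ₗ[R] B}
    {g : B →ₗ[R] C} (h : IsShortExact f g) (φ : A →ₗ[R] R) :
    ∃ ψ : B →ₗ[R] R, ∀ a, ψ (f a) = φ a := by
  obtain ⟨s, hs⟩ := exists_comp_eq_of_injective h.injective (LinearMap.ker g).subtype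
    (fun x => (h.exact x).1 x.2)
  obtain ⟨ψ, hψ⟩ := hC B g h.surjective (φ ∘ₗ s)
  refine ⟨ψ, fun a => ?_⟩
  have := hψ ⟨f a, h.comp_apply a⟩
  rw [this]
  exact congrArg φ (h.injective (hs ⟨f a, h.comp_apply a⟩))

theorem HasTrivialExtOne.exists_extension_free (hC : HasTrivialExtOne R C) {f : A →ₗ[R] B}
    {g : B →ₗ[R] C} (h : IsShortExact f g) {m : ℕ} (φ : A →ₗ[R] (Fin m → R)) :
    ∃ ψ : B →ₗ[R] (Fin m → R), ∀ a, ψ (f a) = φ a := by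
  choose ψ hψ using fun j => hC.exists_extension h (LinearMap.proj j ∘ₗ φ)
  exact ⟨LinearMap.pi ψ, fun a => by ext j; simp [hψ]⟩

/-- One projective presentation decides the matter: lifting `B → C` to `N` exhibits `N` as the
pushout of `ker p` and `B` along `A`, so a functional on `ker p` and an extension over `B` of its
restriction to `A` glue. -/
theorem hasTrivialExtOne_of_presentation [Module.Projective R B] {f : A →ₗ[R] B} {g : B →ₗ[R] C}
    (h : IsShortExact f g) (hext : ∀ φ : A →ₗ[R] R, ∃ ψ : B →ₗ[R] R, ∀ a, ψ (f a) = φ a) :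
    HasTrivialExtOne R C := by
  intro N _ _ p hp φ
  obtain ⟨s, hs⟩ := Module.projective_lifting_property p g hp
  have hs' : ∀ x, p (s x) = g x := fun x => LinearMap.congr_fun hs x
  let θ : A →ₗ[R] LinearMap.ker p :=
    (s ∘ₗ f).codRestrict _ fun a => by simp [hs', h.comp_apply]
  obtain ⟨χ, hχ⟩ := hext (φ ∘ₗ θ)
  let P : (LinearMap.ker p × B) →ₗ[R] N := LinearMap.coprod (LinearMap.ker p).subtype s
  have hP : Function.Surjective P := fun n => by
    obtain ⟨x, hx⟩ := h.surjective (p n)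
    refine ⟨(⟨n - s x, by simp [hs', hx]⟩, x), by simp [P]⟩
  obtain ⟨ψ, hψ⟩ := exists_comp_eq_of_surjective hP (LinearMap.coprod φ χ) (by
    rintro ⟨a, x⟩ hax
    have hax' : (a : N) + s x = 0 := by simpa [P] using hax
    have hx : g x = 0 := by
      have := congrArg p hax'
      simpa [hs'] using this
    obtain ⟨y, rfl⟩ := (h.exact x).1 hx
    have ha : a = -θ y := by
      ext
      simpa [θ] using eq_neg_of_add_eq_zero_left hax'
    simp [ha, hχ])
  refine ⟨ψ, fun x => ?_⟩
  simpa [P] using hψ (x, 0)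

theorem hasTrivialExtOne_of_free [Module.Projective R A] : HasTrivialExtOne R A := by
  refine hasTrivialExtOne_of_presentation (A := PUnit.{u+1}) (B := A) (f := 0) (g := LinearMap.id)
    ⟨fun _ _ _ => rfl, fun b => ?_, fun b => ⟨b, rfl⟩⟩ (fun φ => ⟨0, fun a => ?_⟩)
  · constructor
    · rintro rfl
      exact ⟨PUnit.unit, rfl⟩
    · rintro ⟨_, rfl⟩
      rfl
  · rw [show a = 0 from rfl, map_zero, map_zero, map_zero]

/-- Extend in two steps along `ker p ⊆ ker (g ∘ p) ⊆ N`, whose successive quotients are `A` and `C`.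
-/
theorem HasTrivialExtOne.of_isShortExact (hA : HasTrivialExtOne R A) (hC : HasTrivialExtOne R C)
    {f : A →ₗ[R] B} {g : B →ₗ[R] C} (h : IsShortExact f g) : HasTrivialExtOne R B := by
  intro N _ _ p hp φ
  let K := LinearMap.ker (g ∘ₗ p)
  obtain ⟨q, hq⟩ := exists_comp_eq_of_injective h.injective (p ∘ₗ K.subtype)
    (fun x => (h.exact _).1 x.2)
  have hq' : Function.Surjective q := fun a => by
    obtain ⟨n, hn⟩ := hp (f a)
    refine ⟨⟨n, by simp [K, hn, h.comp_apply]⟩, h.injective ?_⟩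
    rw [hq]
    simpa using hn
  let θ : LinearMap.ker q →ₗ[R] LinearMap.ker p :=
    (K.subtype ∘ₗ (LinearMap.ker q).subtype).codRestrict _ fun x => by
      have := hq x.1
      rw [show q x.1 = 0 from x.2, map_zero] at this
      simpa using this.symm
  obtain ⟨ψ₁, hψ₁⟩ := hA K q hq' (φ ∘ₗ θ)
  obtain ⟨ψ, hψ⟩ := hC N (g ∘ₗ p) (h.surjective.comp hp) ψ₁
  refine ⟨ψ, fun x => ?_⟩
  have hxK : (x : N) ∈ K := by simp [K]
  have hx0 : q ⟨x, hxK⟩ = 0 := h.injective (by rw [hq]; simp)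
  have h1 := hψ ⟨x, hxK⟩
  have h2 := hψ₁ ⟨⟨x, hxK⟩, hx0⟩
  simp only at h1 h2
  rw [h1, h2]
  rfl

theorem HasTrivialExtOne.of_retract (hB : HasTrivialExtOne R B) {i : A →ₗ[R] B} {r : B →ₗ[R] A}
    (hr : ∀ a, r (i a) = a) : HasTrivialExtOne R A := by
  intro N _ _ p hp φ
  -- pull back along the retraction
  let P : (N × B) →ₗ[R] A := p ∘ₗ LinearMap.fst R N B - r ∘ₗ LinearMap.snd R N B
  let X := LinearMap.ker P
  have hX : ∀ x : X, p x.1.1 = r x.1.2 := fun x => sub_eq_zero.1 (x.2 : P x.1 = 0)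
  let π : X →ₗ[R] B := LinearMap.snd R N B ∘ₗ X.subtype
  have hπ : Function.Surjective π := fun b => by
    obtain ⟨n, hn⟩ := hp (r b)
    exact ⟨⟨(n, b), by simp [X, P, hn]⟩, rfl⟩
  let θ : LinearMap.ker π →ₗ[R] LinearMap.ker p :=
    (LinearMap.fst R N B ∘ₗ X.subtype ∘ₗ (LinearMap.ker π).subtype).codRestrict _ fun x => by
      have h0 : x.1.1.2 = 0 := x.2
      simp [hX, h0]
  obtain ⟨ψ, hψ⟩ := hB X π hπ (φ ∘ₗ θ)
  let j : N →ₗ[R] X := (LinearMap.prod LinearMap.id (i ∘ₗ p)).codRestrict X fun n => by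
    simp [X, P, hr]
  refine ⟨ψ ∘ₗ j, fun x => ?_⟩
  have hx : p x = 0 := x.2
  have hj : π (j x) = 0 := by simp [π, j, hx]
  have := hψ ⟨j x, hj⟩
  simp only [LinearMap.comp_apply] at this ⊢
  rw [this]
  congr 1

end Syzygy

/-! ### Totally reflexive modules -/

section TotallyReflexive

variable {R : Type u} [CommRing R]

/-- A class of modules with `Ext¹(-, R) = 0` that is closed under suitable syzygies and cosyzygies
consists of totally reflexive modules. -/
theorem isTotallyReflexive_of_class (𝒞 : ModuleCat.{u} R → Prop)
    (hext : ∀ M, 𝒞 M → HasTrivialExtOne R M)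
    (hr : ∀ M, 𝒞 M → ∃ N, 𝒞 N ∧ IsSyzygy R M N)
    (hl : ∀ M, 𝒞 M → ∃ N, 𝒞 N ∧ IsSyzygy R N M)
    (M : ModuleCat.{u} R) (hM : 𝒞 M) : IsTotallyReflexive R M := by
  refine ⟨(hl M hM).choose_spec.2.finite, ?_⟩
  choose r hr₁ hr₂ using hr
  choose l hl₁ hl₂ using hl
  let r' : Subtype 𝒞 → Subtype 𝒞 := fun X => ⟨r X.1 X.2, hr₁ _ _⟩
  let l' : Subtype 𝒞 → Subtype 𝒞 := fun X => ⟨l X.1 X.2, hl₁ _ _⟩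
  -- Iterated syzygies in degrees `≥ 0`, iterated cosyzygies in degrees `< 0`; `T 0 = M` is then the
  -- image of `F_0 → F_{-1}`.
  let T : ℤ → Subtype 𝒞
    | Int.ofNat n => l'^[n] ⟨M, hM⟩
    | Int.negSucc n => r'^[n + 1] ⟨M, hM⟩
  have hT : ∀ j, IsSyzygy R (T (j + 1)).1 (T j).1 := by
    rintro (n | _ | n)
    · change IsSyzygy R (l'^[n + 1] ⟨M, hM⟩).1 (l'^[n] ⟨M, hM⟩).1
      rw [Function.iterate_succ_apply']
      exact hl₂ _ _
    · exact hr₂ _ _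
    · change IsSyzygy R (r'^[n + 1] ⟨M, hM⟩).1 (r'^[n + 1 + 1] ⟨M, hM⟩).1
      rw [Function.iterate_succ_apply' _ (n + 1)]
      exact hr₂ _ _
  choose m i p h using hT
  let X : ℤ → ModuleCat.{u} R := fun n => ModuleCat.of R (Fin (m n) → R)
  let d : ∀ n, X (n + 1) ⟶ X n := fun n => ModuleCat.ofHom (i n ∘ₗ p (n + 1))
  let F : ChainComplex (ModuleCat.{u} R) ℤ := ChainComplex.of X d fun n => by
    refine ModuleCat.hom_ext (LinearMap.ext fun x => ?_)
    change i n (p (n + 1) (i (n + 1) (p (n + 1 + 1) x))) = 0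
    rw [(h (n + 1)).comp_apply, map_zero]
  have hd : ∀ n, (F.d (n + 1) n).hom = i n ∘ₗ p (n + 1) := fun n => by
    simp only [F, ChainComplex.of_d]
    rfl
  refine ⟨F, fun n => ⟨?_, ?_⟩, fun n => ?_, fun n => ?_, ?_⟩
  · change Module.Free R (Fin (m n) → R)
    infer_instance
  · change Module.Finite R (Fin (m n) → R)
    infer_instance
  · obtain ⟨k, rfl⟩ : ∃ k, n = k + 1 := ⟨n - 1, by ring⟩
    rw [show k + 1 - 1 = k by ring, hd, hd]
    intro x
    constructor
    · intro hx
      obtain ⟨y, hy⟩ := ((h (k + 1)).exact x).1 ((h k).injective (by simpa using hx))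
      obtain ⟨z, rfl⟩ := (h (k + 1 + 1)).surjective y
      exact ⟨z, hy⟩
    · rintro ⟨z, rfl⟩
      simp [(h (k + 1)).comp_apply]
  · obtain ⟨k, rfl⟩ : ∃ k, n = k + 1 := ⟨n - 1, by ring⟩
    rw [show k + 1 - 1 = k by ring, hd, hd]
    intro φ
    constructor
    · intro hφ
      obtain ⟨ψ, hψ⟩ := exists_comp_eq_of_surjective (h (k + 1)).surjective φ (fun a ha => by
        obtain ⟨y, rfl⟩ := ((h (k + 1)).exact a).1 ha
        obtain ⟨z, rfl⟩ := (h (k + 1 + 1)).surjective y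
        exact LinearMap.congr_fun hφ z)
      -- Exactness of the dual complex is exactly `Ext¹(T k, R) = 0`: the functional on `T (k + 1)`
      -- extends to `F_k`.
      obtain ⟨χ, hχ⟩ := (hext _ (T k).2).exists_extension (h k) ψ
      exact ⟨χ, LinearMap.ext fun x => by
        simp only [LinearMap.lcomp_apply, LinearMap.comp_apply, hχ]
        exact hψ x⟩
    · rintro ⟨χ, rfl⟩
      refine LinearMap.ext fun x => ?_
      change χ (i k (p (k + 1) (i (k + 1) (p (k + 1 + 1) x)))) = 0
      rw [(h (k + 1)).comp_apply, map_zero, map_zero]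
  · have key : ∀ a : ℤ, -1 + 1 = a → Nonempty ((T a).1 ≃ₗ[R] LinearMap.range (F.d a (-1)).hom) := by
      rintro _ rfl
      rw [hd, LinearMap.range_comp_of_range_eq_top _
        (LinearMap.range_eq_top.2 (h (-1 + 1)).surjective)]
      exact ⟨LinearEquiv.ofInjective (i (-1)) (h (-1)).injective⟩
    exact key 0 (by norm_num)

/-- The modules that occur as images in a totally acyclic complex of finite free modules. -/
def IsTotallyAcyclicImage (N : ModuleCat.{u} R) : Prop :=
  ∃ F : ChainComplex (ModuleCat.{u} R) ℤ,
    (∀ n, Module.Free R (F.X n) ∧ Module.Finite R (F.X n)) ∧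
    (∀ n, Function.Exact (F.d (n + 1) n).hom (F.d n (n - 1)).hom) ∧
    (∀ n, Function.Exact (LinearMap.lcomp R R (F.d n (n - 1)).hom)
      (LinearMap.lcomp R R (F.d (n + 1) n).hom)) ∧
    ∃ a b : ℤ, b + 1 = a ∧ Nonempty (N ≃ₗ[R] LinearMap.range (F.d a b).hom)

theorem IsTotallyReflexive.isTotallyAcyclicImage {M : ModuleCat.{u} R}
    (hM : IsTotallyReflexive R M) : IsTotallyAcyclicImage M := by
  obtain ⟨-, F, h1, h2, h3, h4⟩ := hM
  exact ⟨F, h1, h2, h3, 0, -1, rfl, h4⟩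

theorem IsTotallyAcyclicImage.exists_syzygy {M : ModuleCat.{u} R} (hM : IsTotallyAcyclicImage M) :
    HasTrivialExtOne R M ∧ ∃ N : ModuleCat.{u} R, IsTotallyAcyclicImage N ∧ IsSyzygy R N M := by
  obtain ⟨F, h1, h2, h3, a, b, hab, ⟨e⟩⟩ := hM
  obtain rfl : b = a - 1 := by omega
  have := (h1 a).1
  have := (h1 a).2
  have hse : IsShortExact (LinearMap.range (F.d (a + 1) a).hom).subtype
      (e.symm.toLinearMap ∘ₗ (F.d a (a - 1)).hom.rangeRestrict) := by
    refine ⟨Subtype.val_injective, fun x => ?_,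
      e.symm.surjective.comp (LinearMap.surjective_rangeRestrict _)⟩
    have hx := h2 a x
    simp only [LinearMap.comp_apply, LinearEquiv.coe_coe, LinearEquiv.map_eq_zero_iff,
      Submodule.coe_subtype, Subtype.range_coe_subtype, Set.mem_ofPred_eq]
    rw [← Subtype.val_inj]
    exact hx
  refine ⟨hasTrivialExtOne_of_presentation hse fun φ => ?_, ModuleCat.of R _,
    ⟨F, h1, h2, h3, a + 1, a, rfl, ⟨LinearEquiv.refl _ _⟩⟩, hse.isSyzygy⟩
  have h3' := h3 (a + 1)
  rw [show a + 1 - 1 = a by ring] at h3'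
  have h2' := h2 (a + 1)
  rw [show a + 1 - 1 = a by ring] at h2'
  -- Pulled back to `F_{a+1}`, the functional is a cocycle of `Hom(F, R)`, hence factors through
  -- `F_a`.
  obtain ⟨ψ, hψ⟩ := (h3' (φ ∘ₗ (F.d (a + 1) a).hom.rangeRestrict)).1 (LinearMap.ext fun x => by
    have hx : (F.d (a + 1) a).hom.rangeRestrict ((F.d (a + 1 + 1) (a + 1)).hom x) = 0 :=
      Subtype.ext (h2'.apply_apply_eq_zero x)
    simp only [LinearMap.lcomp_apply, LinearMap.comp_apply, hx]
    simp)
  refine ⟨ψ, fun y => ?_⟩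
  obtain ⟨x, rfl⟩ := LinearMap.surjective_rangeRestrict _ y
  exact LinearMap.congr_fun hψ x

theorem IsTotallyAcyclicImage.exists_cosyzygy {M : ModuleCat.{u} R}
    (hM : IsTotallyAcyclicImage M) :
    ∃ N : ModuleCat.{u} R, IsTotallyAcyclicImage N ∧ IsSyzygy R M N := by
  obtain ⟨F, h1, h2, h3, a, b, rfl, ⟨e⟩⟩ := hM
  have := (h1 b).1
  have := (h1 b).2
  have hse : IsShortExact ((LinearMap.range (F.d (b + 1) b).hom).subtype ∘ₗ e.toLinearMap)
      (F.d b (b - 1)).hom.rangeRestrict := by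
    refine ⟨Subtype.val_injective.comp e.injective, fun x => ?_,
      LinearMap.surjective_rangeRestrict _⟩
    have hx := h2 b x
    rw [← Subtype.val_inj]
    refine hx.trans ⟨?_, ?_⟩
    · rintro ⟨y, hy⟩
      exact ⟨e.symm ⟨x, y, hy⟩, by simp⟩
    · rintro ⟨y, rfl⟩
      exact (e y).2
  exact ⟨ModuleCat.of R _, ⟨F, h1, h2, h3, b, b - 1, by ring, ⟨LinearEquiv.refl _ _⟩⟩,
    hse.isSyzygy⟩

/-- Images at arbitrary positions form a class closed under syzygies and cosyzygies, so no complex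
has to be reindexed. -/
theorem isTotallyReflexive_iff_isTotallyAcyclicImage {M : ModuleCat.{u} R} :
    IsTotallyReflexive R M ↔ IsTotallyAcyclicImage M :=
  ⟨IsTotallyReflexive.isTotallyAcyclicImage,
    isTotallyReflexive_of_class _ (fun _ h => h.exists_syzygy.1) (fun _ h => h.exists_cosyzygy)
      (fun _ h => h.exists_syzygy.2) M⟩

theorem IsTotallyReflexive.hasTrivialExtOne {M : ModuleCat.{u} R} (hM : IsTotallyReflexive R M) :
    HasTrivialExtOne R M :=
  hM.isTotallyAcyclicImage.exists_syzygy.1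

theorem IsTotallyReflexive.exists_syzygy {M : ModuleCat.{u} R} (hM : IsTotallyReflexive R M) :
    ∃ N : ModuleCat.{u} R, IsTotallyReflexive R N ∧ IsSyzygy R N M := by
  simpa only [isTotallyReflexive_iff_isTotallyAcyclicImage] using
    hM.isTotallyAcyclicImage.exists_syzygy.2

theorem IsTotallyReflexive.exists_cosyzygy {M : ModuleCat.{u} R} (hM : IsTotallyReflexive R M) :
    ∃ N : ModuleCat.{u} R, IsTotallyReflexive R N ∧ IsSyzygy R M N := by
  simpa only [isTotallyReflexive_iff_isTotallyAcyclicImage] using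
    hM.isTotallyAcyclicImage.exists_cosyzygy

theorem IsTotallyReflexive.of_equiv {M N : ModuleCat.{u} R} (hM : IsTotallyReflexive R M)
    (e : M ≃ₗ[R] N) : IsTotallyReflexive R N := by
  obtain ⟨h, F, h1, h2, h3, ⟨h4⟩⟩ := hM
  exact ⟨Module.Finite.equiv e, F, h1, h2, h3, ⟨e.symm.trans h4⟩⟩

end TotallyReflexive

/-! ### Extensions, kernels and direct summands of totally reflexive modules -/

section Closure

variable {R : Type u} [CommRing R]
variable {A B C : Type u} [AddCommGroup A] [Module R A] [AddCommGroup B] [Module R B]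
  [AddCommGroup C] [Module R C]

/-- The horseshoe lemma, for one syzygy. -/
theorem IsShortExact.exists_syzygy {f : A →ₗ[R] B} {g : B →ₗ[R] C} (h : IsShortExact f g)
    {A₁ C₁ : Type u} [AddCommGroup A₁] [Module R A₁] [AddCommGroup C₁] [Module R C₁]
    (hA : IsSyzygy R A₁ A) (hC : IsSyzygy R C₁ C) :
    ∃ (B₁ : ModuleCat.{u} R) (f₁ : A₁ →ₗ[R] B₁) (g₁ : B₁ →ₗ[R] C₁),
      IsShortExact f₁ g₁ ∧ IsSyzygy R B₁ B := by
  obtain ⟨a, iA, pA, hA⟩ := hA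
  obtain ⟨c, iC, pC, hC⟩ := hC
  obtain ⟨s, hs⟩ := Module.projective_lifting_property g pC h.surjective
  have hs' : ∀ x, g (s x) = pC x := fun x => LinearMap.congr_fun hs x
  let P : ((Fin a → R) × (Fin c → R)) →ₗ[R] B := LinearMap.coprod (f ∘ₗ pA) s
  have hP : Function.Surjective P := fun b => by
    obtain ⟨y, hy⟩ := hC.surjective (g b)
    obtain ⟨z, hz⟩ := (h.exact (b - s y)).1 (by simp [hs', hy])
    obtain ⟨x, rfl⟩ := hA.surjective z
    exact ⟨(x, y), by simp [P, hz]⟩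
  have hgP : ∀ x, g (P x) = pC x.2 := fun x => by simp [P, hs', h.comp_apply]
  obtain ⟨g₁, hg₁⟩ := exists_comp_eq_of_injective hC.injective
    (LinearMap.snd R _ _ ∘ₗ (LinearMap.ker P).subtype) (fun x => (hC.exact _).1 (by
      have := hgP x.1
      rw [show P x.1 = 0 from x.2, map_zero] at this
      exact this.symm))
  let f₁ : A₁ →ₗ[R] LinearMap.ker P :=
    (LinearMap.inl R _ _ ∘ₗ iA).codRestrict _ fun x => by simp [P, hA.comp_apply]
  refine ⟨ModuleCat.of R (LinearMap.ker P), f₁, g₁, ⟨?_, ?_, ?_⟩, (isShortExact_ker hP).isSyzygy⟩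
  · intro x y hxy
    have : iA x = iA y := congrArg (fun z : LinearMap.ker P => z.1.1) hxy
    exact hA.injective this
  · intro x
    constructor
    · intro hx
      have h2 : x.1.2 = 0 := by
        have := hg₁ x
        rw [hx, map_zero] at this
        exact this.symm
      have hx0 : f (pA x.1.1) + s x.1.2 = 0 := x.2
      obtain ⟨y, hy⟩ := (hA.exact x.1.1).1 (h.injective (by simpa [h2] using hx0))
      exact ⟨y, Subtype.ext (Prod.ext hy h2.symm)⟩
    · rintro ⟨y, rfl⟩
      refine hC.injective ?_
      rw [hg₁, map_zero]
      rfl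
  · intro y
    obtain ⟨z, hz⟩ := (h.exact (s (iC y))).1 (by rw [hs', hC.comp_apply])
    obtain ⟨x, rfl⟩ := hA.surjective z
    refine ⟨⟨(-x, iC y), by simp [P, hz]⟩, hC.injective ?_⟩
    rw [hg₁]
    rfl

/-- The dual horseshoe lemma, for one cosyzygy. -/
theorem IsShortExact.exists_cosyzygy {f : A →ₗ[R] B} {g : B →ₗ[R] C} (h : IsShortExact f g)
    {A₁ C₁ : Type u} [AddCommGroup A₁] [Module R A₁] [AddCommGroup C₁] [Module R C₁]
    (hext : HasTrivialExtOne R C) (hA : IsSyzygy R A A₁) (hC : IsSyzygy R C C₁) :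
    ∃ (B₁ : ModuleCat.{u} R) (f₁ : A₁ →ₗ[R] B₁) (g₁ : B₁ →ₗ[R] C₁),
      IsShortExact f₁ g₁ ∧ IsSyzygy R B B₁ := by
  obtain ⟨a, iA, pA, hA⟩ := hA
  obtain ⟨c, iC, pC, hC⟩ := hC
  -- Free modules are not injective; `Ext¹(C, R) = 0` is what lets the embedding of `A` extend to
  -- `B`.
  obtain ⟨ψ, hψ⟩ := hext.exists_extension_free h iA
  let J : B →ₗ[R] ((Fin a → R) × (Fin c → R)) := LinearMap.prod ψ (iC ∘ₗ g)
  have hJ' : ∀ b, iC (g b) = 0 → ∃ z, f z = b ∧ ψ b = iA z := fun b hb => by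
    obtain ⟨z, rfl⟩ := (h.exact b).1 (hC.injective (by simpa using hb))
    exact ⟨z, rfl, hψ z⟩
  have hJ : Function.Injective J := by
    rw [injective_iff_map_eq_zero]
    intro b hb
    obtain ⟨z, rfl, hz⟩ := hJ' b (congrArg Prod.snd hb)
    have h1 : ψ (f z) = 0 := congrArg Prod.fst hb
    rw [hz] at h1
    rw [hA.injective (h1.trans (map_zero iA).symm), map_zero]
  have hQ := isShortExact_mkQ hJ
  obtain ⟨f₁, hf₁⟩ := exists_comp_eq_of_surjective hA.surjective
    ((LinearMap.range J).mkQ ∘ₗ LinearMap.inl R _ _) (fun x hx => by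
      obtain ⟨z, rfl⟩ := (hA.exact x).1 hx
      refine (hQ.exact _).2 ⟨f z, Prod.ext (hψ z) ?_⟩
      simp [J, h.comp_apply])
  obtain ⟨g₁, hg₁⟩ := exists_comp_eq_of_surjective hQ.surjective (pC ∘ₗ LinearMap.snd R _ _)
    (fun x hx => by
      obtain ⟨b, rfl⟩ := (hQ.exact x).1 hx
      simp [J, hC.comp_apply])
  refine ⟨ModuleCat.of R (_ ⧸ LinearMap.range J), f₁, g₁, ⟨?_, ?_, ?_⟩, hQ.isSyzygy⟩
  · rw [injective_iff_map_eq_zero]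
    intro z hz
    obtain ⟨x, rfl⟩ := hA.surjective z
    rw [hf₁] at hz
    obtain ⟨b, hb⟩ := (hQ.exact _).1 hz
    obtain ⟨w, rfl, hw⟩ := hJ' b (congrArg Prod.snd hb)
    have h1 : ψ (f w) = x := congrArg Prod.fst hb
    rw [← h1, hw, hA.comp_apply]
  · intro z
    obtain ⟨⟨x, y⟩, rfl⟩ := hQ.surjective z
    rw [hg₁]
    constructor
    · intro hy
      obtain ⟨w, hw⟩ := (hC.exact y).1 hy
      obtain ⟨b, rfl⟩ := h.surjective w
      refine ⟨pA (x - ψ b), ?_⟩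
      rw [hf₁, ← sub_eq_zero, LinearMap.comp_apply, ← map_sub]
      refine (hQ.exact _).2 ⟨-b, Prod.ext ?_ ?_⟩
      · simp [J]
      · simp [J, hw]
    · rintro ⟨w, hw⟩
      obtain ⟨v, rfl⟩ := hA.surjective w
      rw [hf₁] at hw
      have := congrArg g₁ hw
      rw [hg₁, LinearMap.comp_apply, hg₁] at this
      rw [← this]
      simp
  · intro z
    obtain ⟨y, rfl⟩ := hC.surjective z
    exact ⟨(LinearMap.range J).mkQ (0, y), by rw [hg₁]; rfl⟩

/-- Totally reflexive modules are closed under extensions. -/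
theorem IsTotallyReflexive.of_isShortExact {f : A →ₗ[R] B} {g : B →ₗ[R] C} (h : IsShortExact f g)
    (hA : IsTotallyReflexive R (ModuleCat.of R A)) (hC : IsTotallyReflexive R (ModuleCat.of R C)) :
    IsTotallyReflexive R (ModuleCat.of R B) := by
  refine isTotallyReflexive_of_class (fun X => ∃ (A C : ModuleCat.{u} R) (f : A →ₗ[R] X)
    (g : X →ₗ[R] C), IsShortExact f g ∧ IsTotallyReflexive R A ∧ IsTotallyReflexive R C) ?_ ?_ ?_
    (ModuleCat.of R B) ⟨ModuleCat.of R A, ModuleCat.of R C, f, g, h, hA, hC⟩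
  · rintro X ⟨A, C, f, g, h, hA, hC⟩
    exact hA.hasTrivialExtOne.of_isShortExact hC.hasTrivialExtOne h
  · rintro X ⟨A, C, f, g, h, hA, hC⟩
    obtain ⟨A₁, hA₁, hA₁'⟩ := hA.exists_cosyzygy
    obtain ⟨C₁, hC₁, hC₁'⟩ := hC.exists_cosyzygy
    obtain ⟨B₁, f₁, g₁, h₁, hB⟩ := h.exists_cosyzygy hC.hasTrivialExtOne hA₁' hC₁'
    exact ⟨B₁, ⟨A₁, C₁, f₁, g₁, h₁, hA₁, hC₁⟩, hB⟩
  · rintro X ⟨A, C, f, g, h, hA, hC⟩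
    obtain ⟨A₁, hA₁, hA₁'⟩ := hA.exists_syzygy
    obtain ⟨C₁, hC₁, hC₁'⟩ := hC.exists_syzygy
    obtain ⟨B₁, f₁, g₁, h₁, hB⟩ := h.exists_syzygy hA₁' hC₁'
    exact ⟨B₁, ⟨A₁, C₁, f₁, g₁, h₁, hA₁, hC₁⟩, hB⟩

theorem isTotallyReflexive_of_free [Module.Free R A] [Module.Finite R A] :
    IsTotallyReflexive R (ModuleCat.of R A) := by
  refine isTotallyReflexive_of_class (fun X => Module.Free R X ∧ Module.Finite R X) ?_ ?_ ?_
    (ModuleCat.of R A) ⟨‹_›, ‹_›⟩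
  · rintro X ⟨_, _⟩
    exact hasTrivialExtOne_of_free
  · rintro X ⟨_, _⟩
    refine ⟨ModuleCat.of R PUnit.{u + 1}, ⟨inferInstanceAs (Module.Free R PUnit.{u + 1}),
      inferInstanceAs (Module.Finite R PUnit.{u + 1})⟩, ?_⟩
    exact IsShortExact.isSyzygy (f := LinearMap.id) (g := (0 : X →ₗ[R] PUnit.{u + 1}))
      ⟨fun _ _ h => h, fun x => by simp, fun _ => ⟨0, rfl⟩⟩
  · rintro X ⟨_, _⟩
    refine ⟨ModuleCat.of R PUnit.{u + 1}, ⟨inferInstanceAs (Module.Free R PUnit.{u + 1}),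
      inferInstanceAs (Module.Finite R PUnit.{u + 1})⟩, ?_⟩
    refine IsShortExact.isSyzygy (g := LinearMap.id) (f := (0 : PUnit.{u + 1} →ₗ[R] X))
      ⟨fun _ _ h => rfl, fun x => ?_, fun x => ⟨x, rfl⟩⟩
    simp [eq_comm]

/-- If `X × R^m` embeds in `R^q` with totally reflexive cokernel `T`, then `R^q / X` is an extension
of `T` by `R^m`. Dually, the kernel of `R^q → X × R^m → X` is an extension of `R^m` by a syzygy.
Both are themselves totally reflexive, so the free complement of the new module may be taken of rank
`0`. -/
theorem IsTotallyReflexive.of_prod_free {m : ℕ}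
    (hA : IsTotallyReflexive R (ModuleCat.of R (A × (Fin m → R)))) :
    IsTotallyReflexive R (ModuleCat.of R A) := by
  refine isTotallyReflexive_of_class
    (fun X => ∃ m : ℕ, IsTotallyReflexive R (ModuleCat.of R (X × (Fin m → R)))) ?_ ?_ ?_
    (ModuleCat.of R A) ⟨m, hA⟩
  · rintro X ⟨m, hX⟩
    exact hX.hasTrivialExtOne.of_retract (i := LinearMap.inl R X (Fin m → R))
      (r := LinearMap.fst R X (Fin m → R)) fun _ => rfl
  · rintro X ⟨m, hX⟩
    obtain ⟨T, hT, q, i, p, h⟩ := hX.exists_cosyzygy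
    have hQ := isShortExact_mkQ (f := i ∘ₗ LinearMap.inl R X (Fin m → R))
      (h.injective.comp LinearMap.inl_injective)
    obtain ⟨g, hg⟩ := exists_comp_eq_of_surjective hQ.surjective p (fun x hx => by
      obtain ⟨y, rfl⟩ := (hQ.exact x).1 hx
      exact h.comp_apply _)
    refine ⟨ModuleCat.of R _, ⟨0, ?_⟩, hQ.isSyzygy⟩
    have hN : IsTotallyReflexive R (ModuleCat.of R
        ((Fin q → R) ⧸ LinearMap.range (i ∘ₗ LinearMap.inl R X (Fin m → R)))) := by
      refine IsTotallyReflexive.of_isShortExact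
        (f := (LinearMap.range (i ∘ₗ LinearMap.inl R X (Fin m → R))).mkQ ∘ₗ i ∘ₗ
          LinearMap.inr R X (Fin m → R)) (g := g) ⟨?_, ?_, ?_⟩ isTotallyReflexive_of_free hT
      · rw [injective_iff_map_eq_zero]
        intro y hy
        obtain ⟨x, hx⟩ := (hQ.exact _).1 hy
        exact (congrArg Prod.snd (h.injective hx)).symm
      · intro z
        obtain ⟨w, rfl⟩ := hQ.surjective z
        rw [hg]
        constructor
        · intro hw
          obtain ⟨⟨x, y⟩, rfl⟩ := (h.exact w).1 hw
          refine ⟨y, ?_⟩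
          rw [← sub_eq_zero, LinearMap.comp_apply, ← map_sub]
          refine (hQ.exact _).2 ⟨-x, ?_⟩
          simp [← map_sub]
        · rintro ⟨y, hy⟩
          rw [← hg, ← hy]
          simp only [LinearMap.comp_apply, hg]
          exact h.comp_apply _
      · intro t
        obtain ⟨w, rfl⟩ := h.surjective t
        exact ⟨_, hg w⟩
    exact hN.of_equiv (LinearEquiv.prodUnique (R := R)).symm
  · rintro X ⟨m, hX⟩
    obtain ⟨T, hT, q, i, p, h⟩ := hX.exists_syzygy
    have hP : Function.Surjective (LinearMap.fst R X (Fin m → R) ∘ₗ p) :=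
      Function.Surjective.comp (g := LinearMap.fst R X (Fin m → R)) Prod.fst_surjective h.surjective
    refine ⟨ModuleCat.of R _, ⟨0, ?_⟩, (isShortExact_ker hP).isSyzygy⟩
    have hN : IsTotallyReflexive R (ModuleCat.of R
        (LinearMap.ker (LinearMap.fst R X (Fin m → R) ∘ₗ p))) := by
      refine IsTotallyReflexive.of_isShortExact
        (f := i.codRestrict _ fun t => by simp [h.comp_apply])
        (g := LinearMap.snd R X (Fin m → R) ∘ₗ p ∘ₗ Submodule.subtype _) ⟨?_, ?_, ?_⟩ hT
        isTotallyReflexive_of_free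
      · intro x y hxy
        exact h.injective (congrArg Subtype.val hxy)
      · intro z
        constructor
        · intro hz
          obtain ⟨t, ht⟩ := (h.exact z.1).1 (Prod.ext z.2 hz)
          exact ⟨t, Subtype.ext ht⟩
        · rintro ⟨t, rfl⟩
          simp [h.comp_apply]
      · intro y
        obtain ⟨w, hw⟩ := h.surjective (0, y)
        exact ⟨⟨w, by simp [hw]⟩, by simp [hw]⟩
    exact hN.of_equiv (LinearEquiv.prodUnique (R := R)).symm

/-- The kernel of a surjection of totally reflexive modules is totally reflexive. -/
theorem IsTotallyReflexive.of_isShortExact_left {f : A →ₗ[R] B} {g : B →ₗ[R] C}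
    (h : IsShortExact f g) (hB : IsTotallyReflexive R (ModuleCat.of R B))
    (hC : IsTotallyReflexive R (ModuleCat.of R C)) : IsTotallyReflexive R (ModuleCat.of R A) := by
  obtain ⟨C₁, hC₁, m, i, p, hp⟩ := hC.exists_syzygy
  obtain ⟨s, hs⟩ := Module.projective_lifting_property g p h.surjective
  have hs' : ∀ x, g (s x) = p x := fun x => LinearMap.congr_fun hs x
  -- `A × R^m` is the pullback of `B → C ← R^m`, an extension of `B` by `C₁`
  have hs₁ : ∀ c, g (s (-(i c))) = 0 := fun c => by simp [hs', hp.comp_apply]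
  obtain ⟨t, ht⟩ := exists_comp_eq_of_injective h.injective (-(s ∘ₗ i))
    (fun c => (h.exact _).1 (by simpa using hs₁ c))
  refine IsTotallyReflexive.of_prod_free (m := m) (IsTotallyReflexive.of_isShortExact
    (f := LinearMap.prod t i) (g := LinearMap.coprod f s) ⟨?_, ?_, ?_⟩ hC₁ hB)
  · intro x y hxy
    exact hp.injective (congrArg Prod.snd hxy)
  · rintro ⟨a, x⟩
    constructor
    · intro hx
      have hx' : f a + s x = 0 := by simpa using hx
      obtain ⟨c, rfl⟩ := (hp.exact x).1 (by
        have := congrArg g hx'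
        simpa [hs', h.comp_apply] using this)
      refine ⟨c, Prod.ext (h.injective ?_) rfl⟩
      simpa [ht] using (eq_neg_of_add_eq_zero_left hx').symm
    · rintro ⟨c, hc⟩
      rw [← hc]
      simp [ht]
  · intro b
    obtain ⟨x, hx⟩ := hp.surjective (g b)
    obtain ⟨a, ha⟩ := (h.exact (b - s x)).1 (by simp [hs', hx])
    exact ⟨(a, x), by simp [ha]⟩

/-- A module with a totally reflexive syzygy is totally reflexive if the functionals on that
syzygy extend. -/
theorem IsTotallyReflexive.of_syzygy {m : ℕ} {i : A →ₗ[R] (Fin m → R)} {p : (Fin m → R) →ₗ[R] B}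
    (h : IsShortExact i p) (hA : IsTotallyReflexive R (ModuleCat.of R A))
    (hext : ∀ φ : A →ₗ[R] R, ∃ ψ : (Fin m → R) →ₗ[R] R, ∀ a, ψ (i a) = φ a) :
    IsTotallyReflexive R (ModuleCat.of R B) := by
  obtain ⟨T, hT, q, j, π, hπ⟩ := hA.exists_cosyzygy
  -- The pushout of `R^m ← A → R^q` is an extension of `T` by `R^m`. It is also an extension of `B`
  -- by `R^q`, which splits because `Ext¹(B, R) = 0`; the map `J` gives the splitting.
  obtain ⟨J, hJ⟩ := (hasTrivialExtOne_of_presentation h hext).exists_extension_free h j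
  obtain ⟨g, hg⟩ := exists_comp_eq_of_surjective
    (p := LinearMap.prodMap p (LinearMap.id : (Fin q → R) →ₗ[R] (Fin q → R)))
    (h.surjective.prodMap Function.surjective_id)
    (π ∘ₗ (LinearMap.snd R _ _ - J ∘ₗ LinearMap.fst R _ _)) (by
      rintro ⟨y, z⟩ hyz
      obtain ⟨a, rfl⟩ := (h.exact y).1 (congrArg Prod.fst hyz)
      have hz : z = 0 := congrArg Prod.snd hyz
      have : π (j a) = 0 := hπ.comp_apply a
      simp [hz, hJ, this])
  have hg' : ∀ y z, g (p y, z) = π (z - J y) := fun y z => hg (y, z)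
  refine IsTotallyReflexive.of_prod_free (m := q) (IsTotallyReflexive.of_isShortExact
    (f := LinearMap.prod p J) (g := g) ⟨?_, ?_, ?_⟩ isTotallyReflexive_of_free hT)
  · rw [injective_iff_map_eq_zero]
    intro y hy
    obtain ⟨a, rfl⟩ := (h.exact y).1 (congrArg Prod.fst hy)
    have h2 : J (i a) = 0 := congrArg Prod.snd hy
    rw [hJ] at h2
    rw [hπ.injective (h2.trans (map_zero j).symm), map_zero]
  · rintro ⟨b, z⟩
    obtain ⟨y, rfl⟩ := h.surjective b
    rw [hg']
    constructor
    · intro hz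
      obtain ⟨a, ha⟩ := (hπ.exact _).1 hz
      exact ⟨y + i a, Prod.ext (by simp [h.comp_apply]) (by simp [hJ, ha])⟩
    · rintro ⟨w, hw⟩
      have h1 : g (p w, J w) = 0 := by rw [hg']; simp
      rw [← hg']
      rw [← h1]
      congr 1
      exact hw.symm
  · intro t
    obtain ⟨z, rfl⟩ := hπ.surjective t
    exact ⟨(p 0, z), by rw [hg']; simp⟩

end Closure

/-! ### The functors `Ext^i(k, -)` -/

theorem IsShortExact.shortExact {R : Type u} [CommRing R] {A B C : Type u} [AddCommGroup A]
    [Module R A] [AddCommGroup B] [Module R B] [AddCommGroup C] [Module R C]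
    {f : A →ₗ[R] B} {g : B →ₗ[R] C} (h : IsShortExact f g) :
    (ShortComplex.mk (ModuleCat.ofHom f) (ModuleCat.ofHom g)
      (ModuleCat.hom_ext (LinearMap.ext h.comp_apply))).ShortExact where
  exact := (ShortComplex.moduleCat_exact_iff _).2 fun x hx => (h.exact x).1 hx
  mono_f := (ModuleCat.mono_iff_injective _).2 h.injective
  epi_g := (ModuleCat.epi_iff_surjective _).2 h.surjective

section ResidueExt

open Abelian

variable (R : Type u) [CommRing R] [IsLocalRing R]

/-- `Ext^i(k, N)`, where `k` is the residue field. -/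
abbrev ResidueExt (N : Type u) [AddCommGroup N] [Module R N] (i : ℕ) : Type u :=
  Ext.{u} (ModuleCat.of R (ResidueField R)) (ModuleCat.of R N) i

variable {R}
variable {A B C : Type u} [AddCommGroup A] [Module R A] [AddCommGroup B] [Module R B]
  [AddCommGroup C] [Module R C]

/-- The map on `Ext^i(k, -)` induced by a linear map. -/
def extMap (i : ℕ) (f : A →ₗ[R] B) : ResidueExt R A i →ₗ[R] ResidueExt R B i :=
  (Ext.mk₀ (ModuleCat.ofHom f)).postcompOfLinear R _ (add_zero i)

theorem extMap_apply (i : ℕ) (f : A →ₗ[R] B) (x : ResidueExt R A i) :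
    extMap i f x = x.comp (Ext.mk₀ (ModuleCat.ofHom f)) (add_zero i) := rfl

theorem extMap_id (i : ℕ) (x : ResidueExt R A i) : extMap i LinearMap.id x = x :=
  Ext.comp_mk₀_id x

theorem extMap_comp (i : ℕ) (f : A →ₗ[R] B) (g : B →ₗ[R] C) (x : ResidueExt R A i) :
    extMap i (g ∘ₗ f) x = extMap i g (extMap i f x) := by
  simp only [extMap_apply, Ext.comp_assoc_of_second_deg_zero, Ext.mk₀_comp_mk₀]
  rfl

theorem extMap_sum (i : ℕ) {ι : Type*} [Fintype ι] (f : ι → A →ₗ[R] B) (x : ResidueExt R A i) :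
    extMap i (∑ j, f j) x = ∑ j, extMap i (f j) x := by
  simp only [extMap_apply]
  rw [← Ext.comp_sum, ← Ext.mk₀_sum]
  congr 2
  ext : 1
  simp [ModuleCat.hom_sum]

theorem extMap_smul (i : ℕ) (a : R) (f : A →ₗ[R] B) (x : ResidueExt R A i) :
    extMap i (a • f) x = a • extMap i f x := by
  rw [extMap_apply, extMap_apply, ← Ext.comp_smul, ← Ext.mk₀_smul]
  rfl

theorem smul_residueExt_eq_zero {a : R} (ha : a ∈ maximalIdeal R) {i : ℕ}
    (x : ResidueExt R A i) : a • x = 0 := by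
  have h : a • 𝟙 (ModuleCat.of R (ResidueField R)) = 0 := by
    refine ModuleCat.hom_ext (LinearMap.ext fun y => ?_)
    change a • y = 0
    rw [Algebra.smul_def, ResidueField.algebraMap_eq, (residue_eq_zero_iff a).2 ha, zero_mul]
  have h2 : a • x = (Ext.mk₀ (a • 𝟙 (ModuleCat.of R (ResidueField R)))).comp x (zero_add i) := by
    simp [Ext.mk₀_smul]
  rw [h2, h, Ext.mk₀_zero, Ext.zero_comp]

theorem IsShortExact.extMap_exact {f : A →ₗ[R] B} {g : B →ₗ[R] C} (h : IsShortExact f g) {i : ℕ}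
    (y : ResidueExt R B i) (hy : extMap i g y = 0) : ∃ x, extMap i f x = y :=
  Ext.covariant_sequence_exact₂ _ h.shortExact y hy

theorem IsShortExact.extMap_zero_injective {f : A →ₗ[R] B} {g : B →ₗ[R] C}
    (h : IsShortExact f g) : Function.Injective (extMap 0 f) := by
  have := h.shortExact.mono_f
  exact Ext.postcomp_mk₀_injective_of_mono _ (ModuleCat.ofHom f)

theorem IsShortExact.extMap_injective {f : A →ₗ[R] B} {g : B →ₗ[R] C} (h : IsShortExact f g)
    {i : ℕ} (hC : Subsingleton (ResidueExt R C i)) : Function.Injective (extMap (i + 1) f) := by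
  rw [injective_iff_map_eq_zero]
  intro x hx
  obtain ⟨y, rfl⟩ := Ext.covariant_sequence_exact₁ _ h.shortExact x hx rfl
  rw [hC.elim y 0, Ext.zero_comp]

theorem IsShortExact.subsingleton_residueExt {f : A →ₗ[R] B} {g : B →ₗ[R] C}
    (h : IsShortExact f g) {i : ℕ} (hB : Subsingleton (ResidueExt R B i))
    (hA : Subsingleton (ResidueExt R A (i + 1))) : Subsingleton (ResidueExt R C i) := by
  refine subsingleton_of_forall_eq 0 fun z => ?_
  obtain ⟨y, rfl⟩ := Ext.covariant_sequence_exact₃ _ h.shortExact z rfl (hA.elim _ _)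
  rw [hB.elim y 0, Ext.zero_comp]

theorem subsingleton_residueExt_of_equiv (e : A ≃ₗ[R] B) {i : ℕ}
    (h : Subsingleton (ResidueExt R A i)) : Subsingleton (ResidueExt R B i) := by
  refine subsingleton_of_forall_eq 0 fun y => ?_
  rw [← extMap_id i y, ← e.comp_symm, extMap_comp, h.elim (extMap i _ y) 0, map_zero]

theorem residueExt_pi_ext {m i : ℕ} {x : ResidueExt R (Fin m → A) i}
    (h : ∀ j, extMap i (LinearMap.proj j : (Fin m → A) →ₗ[R] A) x = 0) : x = 0 := by
  have hid : (LinearMap.id : (Fin m → A) →ₗ[R] (Fin m → A)) =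
      ∑ j, LinearMap.single R (fun _ => A) j ∘ₗ LinearMap.proj j := by
    ext; simp
  rw [← extMap_id i x, hid, extMap_sum]
  refine Finset.sum_eq_zero fun j _ => ?_
  rw [extMap_comp, h, map_zero]

theorem subsingleton_residueExt_pi {m i : ℕ} (h : Subsingleton (ResidueExt R A i)) :
    Subsingleton (ResidueExt R (Fin m → A) i) :=
  subsingleton_of_forall_eq 0 fun _ => residueExt_pi_ext fun _ => h.elim _ _

theorem subsingleton_residueExt_zero_iff :
    Subsingleton (ResidueExt R A 0) ↔ Subsingleton (ResidueField R →ₗ[R] A) :=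
  (Ext.homEquiv₀.trans ModuleCat.homEquiv).subsingleton_congr

/-- If `Hom(k, A) = 0` then `A` has no nonzero element that is killed by a power of the maximal
ideal. -/
theorem eq_zero_of_pow_maximalIdeal_smul (h : Subsingleton (ResidueExt R A 0)) {K : ℕ} {z : A}
    (hz : ∀ a ∈ maximalIdeal R ^ K, a • z = 0) : z = 0 := by
  rw [subsingleton_residueExt_zero_iff] at h
  induction K generalizing z with
  | zero => simpa using hz 1 (by simp)
  | succ K ih =>
    have hz' : ∀ a ∈ maximalIdeal R, a • z = 0 := fun a ha => ih fun b hb => by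
      rw [smul_smul]
      exact hz _ (by rw [pow_succ]; exact Ideal.mul_mem_mul hb ha)
    let φ : ResidueField R →ₗ[R] A := Submodule.liftQ (maximalIdeal R)
      (LinearMap.toSpanSingleton R A z) fun a ha => hz' a ha
    have h1 : φ (residue R 1) = z := by
      change LinearMap.toSpanSingleton R A z 1 = z
      simp
    rw [← h1, h.elim φ 0, LinearMap.zero_apply]

theorem subsingleton_of_pow_maximalIdeal_le_annihilator (h : Subsingleton (ResidueExt R A 0))
    {K : ℕ} (hK : maximalIdeal R ^ K ≤ Module.annihilator R A) : Subsingleton A :=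
  subsingleton_of_forall_eq 0 fun z => eq_zero_of_pow_maximalIdeal_smul h fun _ ha =>
    Module.mem_annihilator.1 (hK ha) z

theorem le_depth_iff {M : ModuleCat.{u} R} {n : ℕ} :
    (n : ℕ∞) ≤ depth R M ↔ ∀ i < n, Subsingleton (ResidueExt R M i) := by
  simp only [depth, le_iInf_iff, Set.mem_ofPred_eq, Nat.cast_le]
  refine forall_congr' fun i => ?_
  rw [← not_nontrivial_iff_subsingleton, ← not_le]
  tauto

theorem depth_lt_top_iff {M : ModuleCat.{u} R} :
    depth R M < ⊤ ↔ ∃ i, Nontrivial (ResidueExt R M i) := by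
  constructor
  · intro h
    by_contra! hc
    refine h.ne (top_le_iff.1 ?_)
    refine le_iInf₂ fun i hi => ?_
    exact absurd (hc i) (not_subsingleton_iff_nontrivial.2 hi)
  · rintro ⟨i, hi⟩
    exact (iInf₂_le i hi).trans_lt (ENat.natCast_lt_top i)

end ResidueExt

/-! ### Regular elements and depth -/

section Regular

open RingTheory.Sequence
open scoped Pointwise

theorem isShortExact_lsmul {R : Type u} [CommRing R] {N : Type u} [AddCommGroup N] [Module R N]
    {x : R} (hx : IsSMulRegular N x) :
    IsShortExact (LinearMap.lsmul R N x) (Submodule.mkQ (x • (⊤ : Submodule R N))) :=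
  ⟨hx, LinearMap.exact_lsmul_mkQ_smul_top N x, Submodule.mkQ_surjective _⟩

variable {R : Type u} [CommRing R] [IsLocalRing R]
variable {N : Type u} [AddCommGroup N] [Module R N]

theorem extMap_lsmul {x : R} (hx : x ∈ maximalIdeal R) {i : ℕ} (y : ResidueExt R N i) :
    extMap i (LinearMap.lsmul R N x) y = 0 := by
  have : LinearMap.lsmul R N x = x • LinearMap.id := by ext; simp
  rw [this, extMap_smul, smul_residueExt_eq_zero hx]

theorem subsingleton_residueExt_quotSMulTop {x : R} (hx : IsSMulRegular N x) {i : ℕ}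
    (h : Subsingleton (ResidueExt R N i)) (h' : Subsingleton (ResidueExt R N (i + 1))) :
    Subsingleton (ResidueExt R (QuotSMulTop x N) i) :=
  (isShortExact_lsmul hx).subsingleton_residueExt h h'

/-- Multiplication by `x` is zero on `Ext(k, N)` because `x` kills `k`, and injective because the
preceding `Ext` of the quotient vanishes. -/
theorem subsingleton_residueExt_of_quotSMulTop {x : R} (hxm : x ∈ maximalIdeal R)
    (hx : IsSMulRegular N x) {n : ℕ}
    (h : ∀ i < n, Subsingleton (ResidueExt R (QuotSMulTop x N) i)) :
    ∀ i < n + 1, Subsingleton (ResidueExt R N i) := by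
  rintro (_ | i) hi
  · exact subsingleton_of_forall_eq 0 fun y =>
      (isShortExact_lsmul hx).extMap_zero_injective ((extMap_lsmul hxm y).trans (map_zero _).symm)
  · exact subsingleton_of_forall_eq 0 fun y =>
      (isShortExact_lsmul hx).extMap_injective (h i (by omega))
        ((extMap_lsmul hxm y).trans (map_zero _).symm)

theorem exists_isSMulRegular_of_subsingleton [IsNoetherianRing R] [Module.Finite R N]
    (h : Subsingleton (ResidueExt R N 0)) : ∃ x ∈ maximalIdeal R, IsSMulRegular N x := by
  rw [subsingleton_residueExt_zero_iff] at h
  have : Module.Finite R (ResidueField R) := inferInstance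
  obtain ⟨x, hx, hreg⟩ := IsSMulRegular.subsingleton_linearMap_iff.1 h
  refine ⟨x, ?_, hreg⟩
  rw [← residue_eq_zero_iff]
  have := Module.mem_annihilator.1 hx 1
  rwa [Algebra.smul_def, mul_one, ResidueField.algebraMap_eq] at this

theorem exists_isRegular_of_forall_subsingleton [IsNoetherianRing R] (n : ℕ) {N : Type u}
    [AddCommGroup N] [Module R N] [Module.Finite R N] [Nontrivial N]
    (h : ∀ i < n, Subsingleton (ResidueExt R N i)) :
    ∃ rs : List R, rs.length = n ∧ (∀ r ∈ rs, r ∈ maximalIdeal R) ∧ IsRegular N rs := by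
  induction n generalizing N with
  | zero => exact ⟨[], rfl, by simp, IsRegular.nil R N⟩
  | succ n ih =>
    obtain ⟨x, hxm, hx⟩ := exists_isSMulRegular_of_subsingleton (h 0 (by omega))
    have := nontrivial_quotSMulTop_of_mem_maximalIdeal N hxm
    obtain ⟨rs, h1, h2, h3⟩ := ih (N := QuotSMulTop x N) fun i hi =>
      subsingleton_residueExt_quotSMulTop hx (h i (by omega)) (h (i + 1) (by omega))
    exact ⟨x :: rs, by simp [h1], List.forall_mem_cons.2 ⟨hxm, h2⟩, IsRegular.cons hx h3⟩

theorem forall_subsingleton_of_isWeaklyRegular {rs : List R} (hm : ∀ r ∈ rs, r ∈ maximalIdeal R)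
    {N : Type u} [AddCommGroup N] [Module R N] (h : IsWeaklyRegular N rs) :
    ∀ i < rs.length, Subsingleton (ResidueExt R N i) := by
  induction rs generalizing N with
  | nil => simp
  | cons x rs ih =>
    rw [isWeaklyRegular_cons_iff] at h
    exact subsingleton_residueExt_of_quotSMulTop (hm x (by simp)) h.1
      (ih (fun r hr => hm r (by simp [hr])) h.2)

/-- Infinite depth passes to quotients by regular sequences. This shows that a big Cohen–Macaulay
module has finite depth. -/
theorem forall_subsingleton_quotient_of_isWeaklyRegular {rs : List R}
    {N : Type u} [AddCommGroup N] [Module R N] (h : IsWeaklyRegular N rs)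
    (hN : ∀ i, Subsingleton (ResidueExt R N i)) :
    ∀ i, Subsingleton (ResidueExt R (N ⧸ (Ideal.ofList rs • ⊤ : Submodule R N)) i) := by
  induction rs generalizing N with
  | nil =>
    intro i
    refine subsingleton_residueExt_of_equiv (Submodule.quotEquivOfEqBot _ ?_).symm (hN i)
    simp
  | cons x rs ih =>
    intro i
    rw [isWeaklyRegular_cons_iff] at h
    exact subsingleton_residueExt_of_equiv
      (Submodule.quotOfListConsSMulTopEquivQuotSMulTopInner N x rs).symm
      (ih h.2 (fun j => subsingleton_residueExt_quotSMulTop h.1 (hN j) (hN (j + 1))) i)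

end Regular

/-! ### Depth of tensor products with totally reflexive modules -/

section TensorDepth

variable {R : Type u} [CommRing R]

theorem IsShortExact.lTensor {A B C : Type u} [AddCommGroup A] [Module R A] [AddCommGroup B]
    [Module R B] [AddCommGroup C] [Module R C] {f : A →ₗ[R] B} {g : B →ₗ[R] C}
    (h : IsShortExact f g) (N : Type u) [AddCommGroup N] [Module R N]
    (hN : Function.Injective (f.lTensor N)) : IsShortExact (f.lTensor N) (g.lTensor N) :=
  ⟨hN, lTensor_exact N h.exact h.surjective, LinearMap.lTensor_surjective N h.surjective⟩

variable [IsLocalRing R]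

theorem subsingleton_residueExt_tensor_free {N : Type u} [AddCommGroup N] [Module R N] {m i : ℕ}
    (h : Subsingleton (ResidueExt R N i)) :
    Subsingleton (ResidueExt R (N ⊗[R] (Fin m → R)) i) :=
  subsingleton_residueExt_of_equiv (TensorProduct.piScalarRight R R N (Fin m)).symm
    (subsingleton_residueExt_pi h)

/-- If tensoring with `N` preserves exactness of sequences of totally reflexive modules, then
`depth (N ⊗ T) ≥ depth N` for every totally reflexive module `T`. -/
theorem IsTotallyReflexive.subsingleton_residueExt_tensor {N : Type u} [AddCommGroup N]
    [Module R N]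
    (hN : ∀ (T T' : ModuleCat.{u} R) (m : ℕ) (i : T →ₗ[R] (Fin m → R))
      (p : (Fin m → R) →ₗ[R] T'), IsTotallyReflexive R T' → IsShortExact i p →
      Function.Injective (i.lTensor N)) {n : ℕ} (h : ∀ i < n, Subsingleton (ResidueExt R N i))
    {T : ModuleCat.{u} R} (hT : IsTotallyReflexive R T) (i : ℕ) (hi : i < n) :
    Subsingleton (ResidueExt R (N ⊗[R] T) i) := by
  -- Embed `T` in a free module with totally reflexive cokernel `T'`: the vanishing of `Ext^i(k, N ⊗
  -- T')` and of `Ext^{i+1}(k, N)` gives that of `Ext^{i+1}(k, N ⊗ T)`.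
  induction i generalizing T with
  | zero =>
    obtain ⟨T', hT', m, j, p, hp⟩ := hT.exists_cosyzygy
    have := subsingleton_residueExt_tensor_free (m := m) (h 0 hi)
    exact (hp.lTensor N (hN _ _ m j p hT' hp)).extMap_zero_injective.subsingleton
  | succ i ih =>
    obtain ⟨T', hT', m, j, p, hp⟩ := hT.exists_cosyzygy
    have := subsingleton_residueExt_tensor_free (m := m) (h (i + 1) hi)
    exact ((hp.lTensor N (hN _ _ m j p hT' hp)).extMap_injective
      (ih hT' (by omega))).subsingleton

theorem IsTotallyReflexive.subsingleton_residueExt {n : ℕ}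
    (h : ∀ i < n, Subsingleton (ResidueExt R R i)) {T : ModuleCat.{u} R}
    (hT : IsTotallyReflexive R T) (i : ℕ) (hi : i < n) : Subsingleton (ResidueExt R T i) :=
  subsingleton_residueExt_of_equiv (TensorProduct.lid R T)
    (IsTotallyReflexive.subsingleton_residueExt_tensor (N := R)
      (fun _ _ _ i _ _ hp =>
        Module.Flat.lTensor_preserves_injective_linearMap i hp.injective) h hT i hi)

end TensorDepth

/-! ### Modules of finite G-dimension -/

section GDim

variable {R : Type u} [CommRing R]

/-- `M` has a totally reflexive `g`-th syzygy. -/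
def GDimLE : ℕ → ModuleCat.{u} R → Prop
  | 0, M => IsTotallyReflexive R M
  | g + 1, M => ∃ K, GDimLE g K ∧ IsSyzygy R K M

theorem GDimLE.succ {g : ℕ} {M : ModuleCat.{u} R} (h : GDimLE g M) : GDimLE (g + 1) M := by
  induction g generalizing M with
  | zero =>
    obtain ⟨K, hK, hKM⟩ := IsTotallyReflexive.exists_syzygy h
    exact ⟨K, hK, hKM⟩
  | succ g ih =>
    obtain ⟨K, hK, hKM⟩ := h
    exact ⟨K, ih hK, hKM⟩

theorem GDimLE.mono {g g' : ℕ} (hg : g ≤ g') {M : ModuleCat.{u} R} (h : GDimLE g M) :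
    GDimLE g' M := by
  induction hg with
  | refl => exact h
  | step _ ih => exact ih.succ

theorem GDimLE.of_isShortExact_middle {g : ℕ} {A B C : ModuleCat.{u} R} {f : A →ₗ[R] B}
    {q : B →ₗ[R] C} (h : IsShortExact f q) (hA : GDimLE g A) (hC : GDimLE g C) : GDimLE g B := by
  induction g generalizing A B C with
  | zero => exact IsTotallyReflexive.of_isShortExact h hA hC
  | succ g ih =>
    obtain ⟨A₁, hA₁, hA⟩ := hA
    obtain ⟨C₁, hC₁, hC⟩ := hC
    obtain ⟨B₁, f₁, q₁, h₁, hB⟩ := h.exists_syzygy hA hC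
    exact ⟨B₁, ih h₁ hA₁ hC₁, hB⟩

/-- The kernel of `R^m → B → C` is an extension of `A` by the chosen syzygy of `B`. -/
theorem GDimLE.of_isShortExact_right {g : ℕ} {A B C : ModuleCat.{u} R} {f : A →ₗ[R] B}
    {q : B →ₗ[R] C} (h : IsShortExact f q) (hA : GDimLE g A) (hB : GDimLE (g + 1) B) :
    GDimLE (g + 1) C := by
  obtain ⟨B₁, hB₁, m, i, p, hp⟩ := hB
  have hqp : Function.Surjective (q ∘ₗ p) := h.surjective.comp hp.surjective
  obtain ⟨s, hs⟩ := exists_comp_eq_of_injective h.injective (p ∘ₗ (LinearMap.ker (q ∘ₗ p)).subtype)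
    (fun x => (h.exact _).1 x.2)
  refine ⟨ModuleCat.of R (LinearMap.ker (q ∘ₗ p)), ?_, (isShortExact_ker hqp).isSyzygy⟩
  refine GDimLE.of_isShortExact_middle (A := B₁) (C := A)
    (f := i.codRestrict _ fun x => by simp [hp.comp_apply]) (q := s) ⟨?_, ?_, ?_⟩ hB₁ hA
  · intro x y hxy
    exact hp.injective (congrArg Subtype.val hxy)
  · intro x
    constructor
    · intro hx
      have h1 := hs x
      rw [hx, map_zero] at h1
      obtain ⟨y, hy⟩ := (hp.exact x.1).1 h1.symm
      exact ⟨y, Subtype.ext hy⟩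
    · rintro ⟨y, rfl⟩
      refine h.injective ?_
      rw [hs]
      exact (hp.comp_apply y).trans (map_zero f).symm
  · intro a
    obtain ⟨x, hx⟩ := hp.surjective (f a)
    exact ⟨⟨x, by simp [hx, h.comp_apply]⟩, h.injective (by rw [hs]; exact hx)⟩

theorem exists_gDimLE_of_isShortExact {A B C : ModuleCat.{u} R} {f : A →ₗ[R] B}
    {q : B →ₗ[R] C} (h : IsShortExact f q) (hA : ∃ g, GDimLE g A) (hB : ∃ g, GDimLE g B) :
    ∃ g, GDimLE g C := by
  obtain ⟨a, hA⟩ := hA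
  obtain ⟨b, hB⟩ := hB
  exact ⟨max a b + 1, GDimLE.of_isShortExact_right h (hA.mono (le_max_left a b))
    (hB.mono ((le_max_right a b).trans (Nat.le_succ _)))⟩

end GDim

/-! ### The Auslander–Bridger inequality -/

section AuslanderBridger

variable {R : Type u} [CommRing R] [IsLocalRing R]

theorem exists_linearMap_residueField {N : Type u} [AddCommGroup N] [Module R N]
    [Module.Finite R N] {S : Submodule R N} (hS : S ≠ ⊤) :
    ∃ l : N →ₗ[R] ResidueField R, l ≠ 0 ∧ ∀ x ∈ S, l x = 0 := by
  obtain ⟨V, hV, hSV⟩ := (eq_top_or_exists_le_coatom S).resolve_left hS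
  have : IsSimpleModule R (N ⧸ V) := isSimpleModule_iff_isCoatom.2 hV
  obtain ⟨I, hI, ⟨e⟩⟩ := isSimpleModule_iff_quot_maximal.1 this
  obtain rfl := eq_maximalIdeal hI
  obtain ⟨e⟩ : Nonempty ((N ⧸ V) ≃ₗ[R] ResidueField R) := ⟨e⟩
  refine ⟨e.toLinearMap ∘ₗ V.mkQ, fun h0 => hV.1 ?_, fun x hx => ?_⟩
  · refine Submodule.eq_top_iff'.2 fun x => ?_
    have := LinearMap.congr_fun h0 x
    simpa using this
  · have : V.mkQ x = 0 := by simpa using hSV hx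
    rw [LinearMap.comp_apply, this, map_zero]

/-- If some functional on a totally reflexive module `T` does not extend along `T → R^m`, then
the induced map on `Ext^r(k, -)` is not injective, where `r` is the depth of `R`. -/
theorem IsTotallyReflexive.exists_extMap_eq_zero {r : ℕ}
    (hR : ∀ i < r, Subsingleton (ResidueExt R R i)) {e : ResidueExt R R r} (he : e ≠ 0)
    {T : ModuleCat.{u} R} (hT : IsTotallyReflexive R T) {m : ℕ} (f : T →ₗ[R] (Fin m → R))
    (hf : ¬ ∀ φ : T →ₗ[R] R, ∃ ψ : (Fin m → R) →ₗ[R] R, ∀ a, ψ (f a) = φ a) :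
    ∃ τ : ResidueExt R T r, τ ≠ 0 ∧ extMap r f τ = 0 := by
  -- The aim is a class `τ` that each functional `φ` on `T` sends to `l φ • e`, where `l` is a
  -- nonzero map from the dual of `T` to `k` killing the functionals that factor through `f`. Then
  -- `τ ≠ 0` since `l ≠ 0`, and `f` kills `τ`. The class is built as `E` in `Ext^r(k, R^q)`, with
  -- coordinates lifting the values of `l`, and then descended to `T`.
  obtain ⟨T₁, hT₁, q, j, π, hπ⟩ := hT.exists_cosyzygy
  obtain ⟨T₂, hT₂, q', j', π', hπ'⟩ := hT₁.exists_cosyzygy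
  have hext : ∀ φ : T →ₗ[R] R, ∃ h : (Fin q → R) →ₗ[R] R, h ∘ₗ j = φ := fun φ => by
    obtain ⟨h, hh⟩ := hT₁.hasTrivialExtOne.exists_extension hπ φ
    exact ⟨h, LinearMap.ext hh⟩
  have : Module.Finite R (T →ₗ[R] R) := Module.Finite.of_surjective (LinearMap.lcomp R R j) hext
  obtain ⟨l, hl, hlS⟩ := exists_linearMap_residueField
    (S := LinearMap.range (LinearMap.lcomp R R f)) (fun htop => hf fun φ => by
      obtain ⟨ψ, hψ⟩ := (htop ▸ Submodule.mem_top : φ ∈ LinearMap.range (LinearMap.lcomp R R f))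
      exact ⟨ψ, fun a => LinearMap.congr_fun hψ a⟩)
  choose c hc using fun s : Fin q => residue_surjective (l (LinearMap.proj s ∘ₗ j))
  let E : ResidueExt R (Fin q → R) r :=
    ∑ s, extMap r (LinearMap.single R (fun _ => R) s) (c s • e)
  have hE : ∀ h : (Fin q → R) →ₗ[R] R,
      extMap r h E = (∑ s, h (Pi.single s 1) * c s) • e := fun h => by
    simp only [E, map_sum, Finset.sum_smul]
    refine Finset.sum_congr rfl fun s _ => ?_
    have : h ∘ₗ LinearMap.single R (fun _ => R) s = h (Pi.single s 1) • LinearMap.id := by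
      ext; simp
    rw [← extMap_comp, this, extMap_smul, extMap_id, smul_smul]
  have hres : ∀ h : (Fin q → R) →ₗ[R] R,
      residue R (∑ s, h (Pi.single s 1) * c s) = l (h ∘ₗ j) := fun h => by
    have h1 : h ∘ₗ j = ∑ s, h (Pi.single s 1) • (LinearMap.proj s ∘ₗ j) := by
      ext t
      simp only [LinearMap.comp_apply, LinearMap.sum_apply, LinearMap.smul_apply]
      rw [LinearMap.pi_apply_eq_sum_univ h (j t)]
      refine Finset.sum_congr rfl fun s _ => ?_
      simp only [smul_eq_mul, LinearMap.proj_apply]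
      rw [mul_comm]
      congr 2
      ext a
      simp [Pi.single_apply, eq_comm]
    rw [h1, map_sum, map_sum]
    refine Finset.sum_congr rfl fun s _ => ?_
    rw [map_mul, hc, map_smul, Algebra.smul_def, ResidueField.algebraMap_eq]
  have hE0 : ∀ h : (Fin q → R) →ₗ[R] R, l (h ∘ₗ j) = 0 → extMap r h E = 0 := fun h h0 => by
    rw [hE]
    exact smul_residueExt_eq_zero ((residue_eq_zero_iff _).1 ((hres h).trans h0)) e
  have hE1 : ∀ h : (Fin q → R) →ₗ[R] R, l (h ∘ₗ j) ≠ 0 → extMap r h E ≠ 0 := fun h h0 => by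
    rw [hE]
    have hu : IsUnit (∑ s, h (Pi.single s 1) * c s) := by
      rw [← residue_ne_zero_iff_isUnit, hres]
      exact h0
    rwa [Ne, hu.smul_eq_zero]
  -- The second cosyzygy lets the vanishing of the image of `E` in `Ext^r(k, T₁)` be tested on
  -- coordinates of a free module; there the functionals factor through `π` and vanish on `T`.
  have hinj : Function.Injective (extMap r j') := by
    cases r with
    | zero => exact hπ'.extMap_zero_injective
    | succ r => exact hπ'.extMap_injective (hT₂.subsingleton_residueExt hR r (by omega))
  obtain ⟨τ, hτ⟩ := hπ.extMap_exact E (hinj (by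
    rw [map_zero]
    refine residueExt_pi_ext fun s => ?_
    rw [← extMap_comp, ← extMap_comp]
    refine hE0 _ ?_
    have : ((LinearMap.proj s ∘ₗ j') ∘ₗ π : (Fin q → R) →ₗ[R] R) ∘ₗ j = 0 := by
      ext t
      simp [hπ.comp_apply]
    rw [this, map_zero]))
  refine ⟨τ, ?_, residueExt_pi_ext fun s => ?_⟩
  · rintro rfl
    refine hl (LinearMap.ext fun φ => ?_)
    obtain ⟨h, rfl⟩ := hext φ
    by_contra h0
    exact hE1 h h0 (by rw [← hτ, map_zero, map_zero])
  · obtain ⟨h, hh⟩ := hext (LinearMap.proj s ∘ₗ f)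
    rw [← extMap_comp, ← hh, extMap_comp, hτ]
    exact hE0 h (hlS _ ⟨LinearMap.proj s, hh.symm⟩)

/-- The core of the Auslander–Bridger formula. If `M` is not totally reflexive but its syzygy `T`
is, some functional on `T` does not extend to `R^m`; so `Ext^r(k, T) → Ext^r(k, R^m)` is not
injective and `Ext^{r-1}(k, M) ≠ 0`. Each further syzygy lowers the degree by one, as `Ext^i(k, R^m)
= 0` for `i < r`. -/
theorem GDimLE.exists_add_eq_depth {r : ℕ} (hR : ∀ i < r, Subsingleton (ResidueExt R R i))
    (he : Nontrivial (ResidueExt R R r)) {g : ℕ} {M : ModuleCat.{u} R} (h : GDimLE (g + 1) M)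
    (h' : ¬ GDimLE g M) : ∃ s, s + g + 1 = r ∧ Nontrivial (ResidueExt R M s) := by
  induction g generalizing M with
  | zero =>
    obtain ⟨T, hT, m, i, p, hp⟩ := h
    obtain ⟨e, he⟩ := exists_ne (0 : ResidueExt R R r)
    obtain ⟨τ, hτ, hτ'⟩ := IsTotallyReflexive.exists_extMap_eq_zero hR he hT i
      (fun hext => h' (IsTotallyReflexive.of_syzygy hp hT hext))
    cases r with
    | zero => exact absurd (hp.extMap_zero_injective (hτ'.trans (map_zero _).symm)) hτ
    | succ s =>
      refine ⟨s, rfl, not_subsingleton_iff_nontrivial.1 fun hs => hτ ?_⟩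
      exact hp.extMap_injective hs (hτ'.trans (map_zero _).symm)
  | succ g ih =>
    obtain ⟨K, hK, m, i, p, hp⟩ := h
    obtain ⟨s, hs, hns⟩ := ih hK fun hK' => h' ⟨K, hK', m, i, p, hp⟩
    have hfree := subsingleton_residueExt_pi (m := m) (hR s (by omega))
    cases s with
    | zero => exact absurd hp.extMap_zero_injective.subsingleton (not_subsingleton _)
    | succ s =>
      refine ⟨s, by omega, not_subsingleton_iff_nontrivial.1 fun hs' => ?_⟩
      exact absurd (hp.extMap_injective hs').subsingleton (not_subsingleton _)

/-- A module of finite G-dimension has G-dimension at most `depth R`. -/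
theorem exists_gDimLE_le_depth {r : ℕ} (hR : ∀ i < r, Subsingleton (ResidueExt R R i))
    (he : Nontrivial (ResidueExt R R r)) {M : ModuleCat.{u} R} (h : ∃ g, GDimLE g M) :
    ∃ g ≤ r, GDimLE g M := by
  classical
  refine ⟨Nat.find h, ?_, Nat.find_spec h⟩
  rcases hg : Nat.find h with _ | g
  · exact Nat.zero_le r
  · obtain ⟨s, hs, -⟩ := GDimLE.exists_add_eq_depth hR he (hg ▸ Nat.find_spec h)
      (Nat.find_min h (by omega))
    omega

end AuslanderBridger

/-! ### An intersection theorem -/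

section Intersection

variable {R : Type u} [CommRing R]

variable (R) in
/-- Multiplication by `a` on `M` factors through a finite free module. -/
def FactorsThroughFree (a : R) (M : Type u) [AddCommGroup M] [Module R M] : Prop :=
  ∃ (m : ℕ) (s : M →ₗ[R] (Fin m → R)) (t : (Fin m → R) →ₗ[R] M), ∀ x, t (s x) = a • x

theorem factorsThroughFree_of_mem_annihilator {a : R} {M : Type u} [AddCommGroup M] [Module R M]
    (ha : a ∈ Module.annihilator R M) : FactorsThroughFree R a M :=
  ⟨0, 0, 0, fun x => by simp [Module.mem_annihilator.1 ha x]⟩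

/-- Lift the factorization through `R^m → M`; the difference between multiplication by `a` on `R^m`
and this lift lands in `K`. -/
theorem FactorsThroughFree.exists_homotopy {a : R} {K M : Type u} [AddCommGroup K] [Module R K]
    [AddCommGroup M] [Module R M] (ha : FactorsThroughFree R a M) {m : ℕ}
    {i : K →ₗ[R] (Fin m → R)} {p : (Fin m → R) →ₗ[R] M} (h : IsShortExact i p) :
    ∃ t : (Fin m → R) →ₗ[R] K, ∀ x, t (i x) = a • x := by
  obtain ⟨q, s, t, hst⟩ := ha
  obtain ⟨t', ht'⟩ := Module.projective_lifting_property p t h.surjective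
  have ht : ∀ x, p (t' x) = t x := fun x => LinearMap.congr_fun ht' x
  obtain ⟨u, hu⟩ := exists_comp_eq_of_injective h.injective
    (a • LinearMap.id - t' ∘ₗ s ∘ₗ p) (fun x => (h.exact _).1 (by simp [ht, hst]))
  refine ⟨u, fun x => h.injective ?_⟩
  rw [hu]
  simp [h.comp_apply]

theorem FactorsThroughFree.of_isShortExact {a : R} {K M : Type u} [AddCommGroup K] [Module R K]
    [AddCommGroup M] [Module R M] (ha : FactorsThroughFree R a M) {m : ℕ}
    {i : K →ₗ[R] (Fin m → R)} {p : (Fin m → R) →ₗ[R] M} (h : IsShortExact i p) :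
    FactorsThroughFree R a K := by
  obtain ⟨t, ht⟩ := ha.exists_homotopy h
  exact ⟨m, i, t, ht⟩

/-- The kernel of `N ⊗ K → N ⊗ R^m` is `Tor_1(N, M)`, on which `a` acts through `Tor_1` of a free
module. -/
theorem FactorsThroughFree.smul_eq_zero {a : R} {K M : Type u} [AddCommGroup K] [Module R K]
    [AddCommGroup M] [Module R M] (ha : FactorsThroughFree R a M) {m : ℕ}
    {i : K →ₗ[R] (Fin m → R)} {p : (Fin m → R) →ₗ[R] M} (h : IsShortExact i p) {N : Type u}
    [AddCommGroup N] [Module R N] {z : N ⊗[R] K} (hz : i.lTensor N z = 0) : a • z = 0 := by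
  obtain ⟨t, ht⟩ := ha.exists_homotopy h
  have h1 : t ∘ₗ i = a • LinearMap.id := LinearMap.ext ht
  have h2 : (t ∘ₗ i).lTensor N z = a • z := by simp [h1]
  rw [← h2, LinearMap.lTensor_comp_apply, hz, map_zero]

variable [IsLocalRing R]

/-- No `Tor` vanishing is assumed: the kernel of `N ⊗ L → N ⊗ R^m` is killed by a power of `𝔪`,
while `N ⊗ L` has positive depth by induction. The hypothesis on `FactorsThroughFree`, unlike
annihilation of `M`, passes to syzygies. -/
theorem GDimLE.subsingleton_residueExt_tensor {N : Type u} [AddCommGroup N] [Module R N] {n : ℕ}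
    (hN : ∀ T : ModuleCat.{u} R, IsTotallyReflexive R T → ∀ i < n,
      Subsingleton (ResidueExt R (N ⊗[R] T) i)) {K g : ℕ} {M : ModuleCat.{u} R}
    (hM : GDimLE g M) (hK : ∀ a ∈ maximalIdeal R ^ K, FactorsThroughFree R a M) :
    ∀ i, i + g < n → Subsingleton (ResidueExt R (N ⊗[R] M) i) := by
  induction g generalizing M with
  | zero => exact fun i hi => hN M hM i (by omega)
  | succ g ih =>
    intro i hi
    obtain ⟨L, hL, m, j, p, hp⟩ := hM
    have hL' := ih hL fun a ha => (hK a ha).of_isShortExact hp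
    refine (hp.lTensor N ?_).subsingleton_residueExt
      (hN (ModuleCat.of R (Fin m → R)) isTotallyReflexive_of_free i (by omega))
      (hL' (i + 1) (by omega))
    rw [injective_iff_map_eq_zero]
    exact fun z hz => eq_zero_of_pow_maximalIdeal_smul (hL' 0 (by omega))
      fun a ha => (hK a ha).smul_eq_zero hp hz

/-- A nonzero finite module that is killed by a power of the maximal ideal has G-dimension at
least `n` if there is a module `N ≠ 𝔪 N` with `depth (N ⊗ T) ≥ n` for all totally reflexive `T`. -/
theorem GDimLE.le_of_subsingleton_residueExt_tensor {N : Type u} [AddCommGroup N] [Module R N]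
    {n : ℕ} (hN : ∀ T : ModuleCat.{u} R, IsTotallyReflexive R T → ∀ i < n,
      Subsingleton (ResidueExt R (N ⊗[R] T) i))
    (hN' : (maximalIdeal R • ⊤ : Submodule R N) ≠ ⊤) {K g : ℕ} {M : ModuleCat.{u} R}
    [Module.Finite R M] [Nontrivial M] (hM : GDimLE g M)
    (hK : maximalIdeal R ^ K ≤ Module.annihilator R M) : n ≤ g := by
  by_contra! hng
  have h0 := hM.subsingleton_residueExt_tensor hN
    (fun a ha => factorsThroughFree_of_mem_annihilator (hK ha)) 0 (by omega)
  have hNM : Subsingleton (N ⊗[R] M) := subsingleton_of_pow_maximalIdeal_le_annihilator h0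
    (K := K) fun a ha => Module.mem_annihilator.2 fun z => by
      induction z with
      | zero => simp
      | tmul x y => rw [← TensorProduct.tmul_smul, Module.mem_annihilator.1 (hK ha) y,
          TensorProduct.tmul_zero]
      | add x y hx hy => rw [smul_add, hx, hy, add_zero]
  -- `M` surjects onto `k`, so `N ⊗ M = 0` gives `N ⊗ k = 0`, that is, `N = 𝔪 N`.
  obtain ⟨l, hl, -⟩ := exists_linearMap_residueField (S := (⊥ : Submodule R M)) bot_ne_top
  have hl' : Function.Surjective l := by
    obtain ⟨x, hx⟩ := DFunLike.ne_iff.1 hl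
    intro y
    obtain ⟨a, ha⟩ := residue_surjective (y / l x)
    refine ⟨a • x, ?_⟩
    rw [map_smul, Algebra.smul_def, ResidueField.algebraMap_eq, ha, div_mul_cancel₀ _ hx]
  have hNk : Subsingleton (N ⊗[R] (R ⧸ maximalIdeal R)) :=
    (LinearMap.lTensor_surjective N hl').subsingleton
  have := (TensorProduct.tensorQuotEquivQuotSMul N (maximalIdeal R)).symm.subsingleton
  exact hN' (Submodule.Quotient.subsingleton_iff.1 this)

end Intersection

/-! ### Reduction to modules of dimension zero -/

section DimZero

open scoped Pointwise

variable {R : Type u} [CommRing R] [IsLocalRing R]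

theorem maximalIdeal_le_radical_of_ringKrullDim_le_zero {I : Ideal R}
    (h : ringKrullDim (R ⧸ I) ≤ 0) : maximalIdeal R ≤ I.radical := by
  have : Ring.KrullDimLE 0 (R ⧸ I) := (Order.krullDimLE_iff 0 _).2 h
  rw [Ideal.radical_eq_sInf]
  refine le_sInf ?_
  rintro p ⟨hIp, hp⟩
  have hp' : (p.map (Ideal.Quotient.mk I)).IsPrime :=
    Ideal.map_isPrime_of_surjective Ideal.Quotient.mk_surjective (by simpa using hIp)
  have hmax := hp'.isMaximal'
  have := Ideal.comap_isMaximal_of_surjective _ Ideal.Quotient.mk_surjective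
    (K := p.map (Ideal.Quotient.mk I))
  rw [Ideal.comap_map_of_surjective _ Ideal.Quotient.mk_surjective, ← RingHom.ker_eq_comap_bot,
    Ideal.mk_ker, sup_eq_left.2 hIp] at this
  rw [eq_maximalIdeal this]

/-- Dividing by a regular element lowers the dimension and the depth bound by one each, and `0 → M →
M → M/xM → 0` preserves finite G-dimension. -/
theorem exists_dim_zero_of_supportDim_eq [IsNoetherianRing R] (d : ℕ) {M : ModuleCat.{u} R}
    [Module.Finite R M] [Nontrivial M] (h : ∀ i < d, Subsingleton (ResidueExt R M i))
    (hdim : Module.supportDim R M = d) (hg : ∃ g, GDimLE g M) :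
    ∃ N : ModuleCat.{u} R, Module.Finite R N ∧ Nontrivial N ∧ (∃ g, GDimLE g N) ∧
      ∃ K, maximalIdeal R ^ K ≤ Module.annihilator R N := by
  induction d generalizing M with
  | zero =>
    refine ⟨M, ‹_›, ‹_›, hg, Ideal.exists_pow_le_of_le_radical_of_fg
      (maximalIdeal_le_radical_of_ringKrullDim_le_zero ?_) (IsNoetherian.noetherian _)⟩
    rw [← Module.supportDim_eq_ringKrullDim_quotient_annihilator, hdim]
    simp
  | succ d ih =>
    obtain ⟨x, hxm, hx⟩ := exists_isSMulRegular_of_subsingleton (h 0 (by omega))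
    have := nontrivial_quotSMulTop_of_mem_maximalIdeal M hxm
    have hdim' := Module.supportDim_quotSMulTop_succ_eq_supportDim hx hxm
    refine ih (M := ModuleCat.of R (QuotSMulTop x M)) (fun i hi =>
      subsingleton_residueExt_quotSMulTop hx (h i (by omega)) (h (i + 1) (by omega))) ?_
      (exists_gDimLE_of_isShortExact (A := M) (B := M) (isShortExact_lsmul hx) hg hg)
    rw [hdim, Nat.cast_succ, ENat.WithBot.add_one_cancel] at hdim'
    exact hdim'

end DimZero

/-! ### Modules of finite depth at least the dimension -/

section Koszul

open DerivedCategory Pretriangulated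

universe w

variable {R : Type u} [CommRing R] [HasDerivedCategory.{w} (ModuleCat.{u} R)]

/-- There are no nonzero morphisms from `A`, placed in degree `i`, to `X`. -/
def HomVanishes (A : ModuleCat.{u} R) (X : DerivedCategory (ModuleCat.{u} R)) (i : ℤ) : Prop :=
  ∀ f : (singleFunctor (ModuleCat.{u} R) i).obj A ⟶ X, f = 0

/-- The isomorphism between `A` in degree `n + i`, shifted by `n`, and `A` in degree `i`. -/
def singleShiftIso (A : ModuleCat.{u} R) (n i j : ℤ) (h : n + i = j) :
    ((singleFunctor (ModuleCat.{u} R) j).obj A)⟦n⟧ ≅ (singleFunctor (ModuleCat.{u} R) i).obj A :=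
  ((singleFunctors (ModuleCat.{u} R)).shiftIso n i j h).app A

theorem homVanishes_shift_iff {A : ModuleCat.{u} R} {X : DerivedCategory (ModuleCat.{u} R)}
    {n i j : ℤ} (h : n + i = j) : HomVanishes A (X⟦n⟧) i ↔ HomVanishes A X j := by
  let e := singleShiftIso A n i j h
  constructor
  · intro hX f
    refine (shiftFunctor _ n).map_injective ?_
    rw [Functor.map_zero, ← cancel_epi e.inv, Limits.comp_zero]
    exact hX _
  · intro hX f
    obtain ⟨g, hg⟩ := (shiftFunctor _ n).map_surjective (e.hom ≫ f)
    rw [hX g, Functor.map_zero] at hg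
    rw [← cancel_epi e.hom, ← hg, Limits.comp_zero]

variable {T : Triangle (DerivedCategory (ModuleCat.{u} R))}

theorem HomVanishes.obj₃ {A : ModuleCat.{u} R} {i : ℤ} (hT : T ∈ distTriang _)
    (h₁ : HomVanishes A T.obj₁ (i + 1)) (h₂ : HomVanishes A T.obj₂ i) :
    HomVanishes A T.obj₃ i := by
  intro f
  obtain ⟨g, rfl⟩ := T.coyoneda_exact₃ hT f
    ((homVanishes_shift_iff (n := 1) (add_comm 1 i)).2 h₁ _)
  rw [h₂ g, Limits.zero_comp]

theorem HomVanishes.obj₁ {A : ModuleCat.{u} R} {i : ℤ} (hT : T ∈ distTriang _)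
    (h₃ : HomVanishes A T.obj₃ i)
    (h₁ : ∀ f : (singleFunctor (ModuleCat.{u} R) (i + 1)).obj A ⟶ T.obj₁, f ≫ T.mor₁ = 0) :
    HomVanishes A T.obj₁ (i + 1) := by
  intro f
  let e := singleShiftIso A 1 i (i + 1) (add_comm 1 i)
  refine (shiftFunctor _ (1 : ℤ)).map_injective ?_
  obtain ⟨g, hg⟩ := T.coyoneda_exact₁ hT (e.inv ≫ f⟦(1 : ℤ)⟧') (by
    rw [Category.assoc, ← Functor.map_comp, h₁, Functor.map_zero, Limits.comp_zero])
  rw [h₃ g, Limits.zero_comp] at hg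
  rw [Functor.map_zero, ← cancel_epi e.inv, Limits.comp_zero]
  exact hg

/-- `a` acts nilpotently on `X`. -/
def ActsNilpotently (a : R) (X : DerivedCategory (ModuleCat.{u} R)) : Prop :=
  ∃ k : ℕ, a ^ k • 𝟙 X = 0

/-- One factor `a` makes the endomorphism of the cone factor through `T.obj₂`; a second factor kills
the composite with `T.mor₂`. This is why squares, and hence nilpotent action, appear. -/
theorem smul_smul_id_eq_zero_of_distTriang {a : R} (hT : T ∈ distTriang _)
    (h₃ : T.mor₃ ≫ (a • 𝟙 T.obj₁)⟦(1 : ℤ)⟧' = 0) (h₂ : (a • 𝟙 T.obj₂) ≫ T.mor₂ = 0) :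
    a ^ 2 • 𝟙 T.obj₃ = 0 := by
  obtain ⟨g, hg⟩ := T.coyoneda_exact₃ hT (a • 𝟙 T.obj₃) (by
    rw [← h₃, Functor.map_smul, CategoryTheory.Functor.map_id, Linear.smul_comp, Linear.comp_smul,
      Category.id_comp, Category.comp_id])
  calc a ^ 2 • 𝟙 T.obj₃ = a • (a • 𝟙 T.obj₃) := by rw [smul_smul, pow_two]
    _ = g ≫ (a • 𝟙 T.obj₂) ≫ T.mor₂ := by
      rw [hg, Linear.smul_comp, Linear.comp_smul, Category.id_comp]
    _ = 0 := by rw [h₂, Limits.comp_zero]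

theorem ActsNilpotently.cone {a x : R} {X Y : DerivedCategory (ModuleCat.{u} R)} {f : X ⟶ Y}
    {g : Y ⟶ X⟦(1 : ℤ)⟧} (hT : Triangle.mk (x • 𝟙 X) f g ∈ distTriang _)
    (ha : ActsNilpotently a X) : ActsNilpotently a Y := by
  obtain ⟨k, hk⟩ := ha
  refine ⟨k * 2, ?_⟩
  rw [pow_mul]
  refine smul_smul_id_eq_zero_of_distTriang (T := Triangle.mk (x • 𝟙 X) f g) hT ?_ ?_
  · change g ≫ (a ^ k • 𝟙 X)⟦(1 : ℤ)⟧' = 0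
    rw [hk, Functor.map_zero, Limits.comp_zero]
  · change (a ^ k • 𝟙 X) ≫ f = 0
    rw [hk, Limits.zero_comp]

theorem actsNilpotently_cone {x : R} {X Y : DerivedCategory (ModuleCat.{u} R)} {f : X ⟶ Y}
    {g : Y ⟶ X⟦(1 : ℤ)⟧} (hT : Triangle.mk (x • 𝟙 X) f g ∈ distTriang _) :
    ActsNilpotently x Y :=
  ⟨2, smul_smul_id_eq_zero_of_distTriang (T := Triangle.mk (x • 𝟙 X) f g) hT
    (comp_distTriang_mor_zero₃₁ _ hT) (comp_distTriang_mor_zero₁₂ _ hT)⟩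

theorem homologyFunctor_map_smul_id (a : R) (X : DerivedCategory (ModuleCat.{u} R)) (i : ℤ) :
    (homologyFunctor (ModuleCat.{u} R) i).map (a • 𝟙 X) = a • 𝟙 _ := by
  obtain ⟨K, ⟨e⟩⟩ : ∃ K, Nonempty (Q.obj K ≅ X) := ⟨_, ⟨Q.objObjPreimageIso X⟩⟩
  have h1 : a • 𝟙 X = e.inv ≫ Q.map (a • 𝟙 K) ≫ e.hom := by
    rw [Functor.map_smul, CategoryTheory.Functor.map_id, Linear.smul_comp, Linear.comp_smul,
      Category.id_comp,
      Iso.inv_hom_id]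
  have h2 : HomologicalComplex.homologyMap (a • 𝟙 K) i = a • 𝟙 _ := by
    rw [← HomologicalComplex.homologyMap_id]
    exact ShortComplex.homologyMap_smul (φ := 𝟙 (K.sc i)) a
  let ε : (homologyFunctor (ModuleCat.{u} R) i).obj (Q.obj K) ≅ K.homology i :=
    (homologyFunctorFactors (ModuleCat.{u} R) i).app K
  have hε : (homologyFunctor (ModuleCat.{u} R) i).map (Q.map (a • 𝟙 K)) ≫ ε.hom =
      ε.hom ≫ HomologicalComplex.homologyMap (a • 𝟙 K) i :=
    homologyFunctorFactors_hom_naturality _ _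
  have h3 : (homologyFunctor (ModuleCat.{u} R) i).map (Q.map (a • 𝟙 K)) = a • 𝟙 _ := by
    rw [← cancel_mono ε.hom, hε, h2, Linear.comp_smul, Linear.smul_comp,
      Category.comp_id, Category.id_comp]
  rw [h1, Functor.map_comp, Functor.map_comp, h3, Linear.smul_comp, Linear.comp_smul,
    Category.id_comp, ← Functor.map_comp, Iso.inv_hom_id, CategoryTheory.Functor.map_id]

theorem ActsNilpotently.mem_radical_annihilator {a : R}
    {X : DerivedCategory (ModuleCat.{u} R)} (h : ActsNilpotently a X) (i : ℤ) :
    a ∈ (Module.annihilator R ((homologyFunctor (ModuleCat.{u} R) i).obj X)).radical := by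
  obtain ⟨k, hk⟩ := h
  refine ⟨k, Module.mem_annihilator.2 fun z => ?_⟩
  have h1 := homologyFunctor_map_smul_id (a ^ k) X i
  rw [hk, Functor.map_zero] at h1
  exact (LinearMap.congr_fun (congrArg ModuleCat.Hom.hom h1) z).symm

theorem isZero_homology_obj₃ (hT : T ∈ distTriang _) (i : ℤ)
    (h₂ : Limits.IsZero ((homologyFunctor (ModuleCat.{u} R) i).obj T.obj₂))
    (h₁ : Limits.IsZero ((homologyFunctor (ModuleCat.{u} R) (i + 1)).obj T.obj₁)) :
    Limits.IsZero ((homologyFunctor (ModuleCat.{u} R) i).obj T.obj₃) :=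
  (HomologySequence.exact₃ T hT i (i + 1) rfl).isZero_of_both_zeros
    (h₂.eq_of_src _ _) (h₁.eq_of_tgt _ _)

theorem isLE_obj₃ (hT : T ∈ distTriang _) {n : ℤ} [h₁ : T.obj₁.IsLE n] [h₂ : T.obj₂.IsLE n] :
    T.obj₃.IsLE n := by
  rw [isLE_iff] at *
  exact fun i hi => isZero_homology_obj₃ hT i (h₂ i hi) (h₁ (i + 1) (by omega))

theorem isGE_obj₃ (hT : T ∈ distTriang _) {n : ℤ} [h₁ : T.obj₁.IsGE n] [h₂ : T.obj₂.IsGE n] :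
    T.obj₃.IsGE (n - 1) := by
  rw [isGE_iff] at *
  exact fun i hi => isZero_homology_obj₃ hT i (h₂ i (by omega)) (h₁ (i + 1) (by omega))

theorem surjective_homology_mor₂ (hT : T ∈ distTriang _) {n : ℤ} [h₁ : T.obj₁.IsLE n] :
    Function.Surjective ((homologyFunctor (ModuleCat.{u} R) n).map T.mor₂).hom := by
  rw [← ModuleCat.epi_iff_surjective,
    HomologySequence.epi_homologyMap_mor₂_iff T hT n (n + 1) rfl]
  exact (isZero_of_isLE T.obj₁ n (n + 1) (by omega)).eq_of_tgt _ _

/-- In the lowest degree homology equals cycles, so a map into it is a chain map from `A` placed in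
that degree. -/
theorem eq_zero_of_homVanishes {A : ModuleCat.{u} R} {K : CochainComplex (ModuleCat.{u} R) ℤ}
    {n : ℤ} [K.IsStrictlyGE n] (h : HomVanishes A (Q.obj K) n) (φ : A ⟶ K.homology n) :
    φ = 0 := by
  have hz : Limits.IsZero (K.X (n - 1)) := K.isZero_of_isStrictlyGE n (n - 1) (by omega)
  have : IsIso (K.homologyπ n) := K.isIso_homologyπ (n - 1) n (by simp) (hz.eq_of_src _ _)
  let ψ : (HomologicalComplex.single _ (ComplexShape.up ℤ) n).obj A ⟶ K :=
    HomologicalComplex.mkHomFromSingle (φ ≫ inv (K.homologyπ n) ≫ K.iCycles n) (by simp)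
  let e : (singleFunctor (ModuleCat.{u} R) n).obj A ≅
      Q.obj ((HomologicalComplex.single _ (ComplexShape.up ℤ) n).obj A) :=
    (singleFunctorIsoCompQ (ModuleCat.{u} R) n).app A
  have h0 : Q.map ψ = 0 := by
    rw [← cancel_epi e.hom, Limits.comp_zero]
    exact h _
  let ε (L : CochainComplex (ModuleCat.{u} R) ℤ) :
      (homologyFunctor (ModuleCat.{u} R) n).obj (Q.obj L) ≅ L.homology n :=
    (homologyFunctorFactors (ModuleCat.{u} R) n).app L
  have hε : (homologyFunctor (ModuleCat.{u} R) n).map (Q.map ψ) ≫ (ε _).hom =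
      (ε _).hom ≫ HomologicalComplex.homologyMap ψ n :=
    homologyFunctorFactors_hom_naturality _ _
  have h1 : HomologicalComplex.homologyMap ψ n = 0 := by
    rw [← cancel_epi (ε _).hom, ← hε, h0, Functor.map_zero, Limits.zero_comp, Limits.comp_zero]
  have h2 : HomologicalComplex.cyclesMap ψ n = 0 := by
    rw [← cancel_mono (K.homologyπ n), ← HomologicalComplex.homologyπ_naturality, h1,
      Limits.comp_zero, Limits.zero_comp]
  have : IsIso (HomologicalComplex.iCycles
      ((HomologicalComplex.single (ModuleCat.{u} R) (ComplexShape.up ℤ) n).obj A) n) :=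
    HomologicalComplex.isIso_iCycles _ n (n + 1) (by simp)
      (HomologicalComplex.single_obj_d _ _ _ _ _)
  have h3 : ψ.f n = 0 := by
    rw [← cancel_epi (HomologicalComplex.iCycles _ n), ← HomologicalComplex.cyclesMap_i, h2,
      Limits.zero_comp, Limits.comp_zero]
  rw [HomologicalComplex.mkHomFromSingle_f, Preadditive.IsIso.comp_left_eq_zero,
    ← Category.assoc] at h3
  have h4 := Limits.zero_of_comp_mono _ h3
  simpa using h4

variable [IsLocalRing R]

theorem isZero_homology_of_homVanishes {X : DerivedCategory (ModuleCat.{u} R)} {n : ℤ}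
    [X.IsGE n] (h : HomVanishes (ModuleCat.of R (ResidueField R)) X n) {k : ℕ}
    (hk : maximalIdeal R ^ k ≤
      Module.annihilator R ((homologyFunctor (ModuleCat.{u} R) n).obj X)) :
    Limits.IsZero ((homologyFunctor (ModuleCat.{u} R) n).obj X) := by
  obtain ⟨K, hK, ⟨e⟩⟩ := X.exists_iso_Q_obj_of_isGE n
  let e' : (homologyFunctor (ModuleCat.{u} R) n).obj X ≅ K.homology n :=
    (homologyFunctor _ n).mapIso e ≪≫ (homologyFunctorFactors (ModuleCat.{u} R) n).app K
  have hKV : HomVanishes (ModuleCat.of R (ResidueField R)) (Q.obj K) n := fun f => by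
    rw [← cancel_mono e.inv, Limits.zero_comp]
    exact h _
  rw [ModuleCat.isZero_iff_subsingleton]
  refine subsingleton_of_pow_maximalIdeal_le_annihilator
    (subsingleton_residueExt_zero_iff.2 (subsingleton_of_forall_eq 0 fun φ => ?_)) hk
  have h1 := eq_zero_of_homVanishes hKV (ModuleCat.ofHom φ ≫ e'.hom)
  have h2 := Limits.zero_of_comp_mono _ h1
  exact congrArg ModuleCat.Hom.hom h2

/-- Induction along the Koszul construction. Replacing `X` by the cone of `x` moves `x` into the set
acting nilpotently and shortens the vanishing range by one, matching the shorter list; `H^0` is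
replaced by a quotient, so it stays equal to `𝔪` times itself. When the list is empty, every
homology module is killed by a power of `𝔪` and `X` turns out to be zero. -/
theorem homVanishes_of_list {X : DerivedCategory (ModuleCat.{u} R)} [IsNoetherianRing R]
    (xs : List R) (hxs : ∀ x ∈ xs, x ∈ maximalIdeal R) (s : Set R)
    (hs : ∀ a ∈ s, ActsNilpotently a X)
    (hrad : maximalIdeal R ≤ (Ideal.span s ⊔ Ideal.ofList xs).radical)
    [X.IsLE 0] (hGE : ∃ c : ℤ, X.IsGE c)
    (hV : ∀ i < (xs.length : ℤ), HomVanishes (ModuleCat.of R (ResidueField R)) X i)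
    (hdiv : (maximalIdeal R • ⊤ : Submodule R ((homologyFunctor (ModuleCat.{u} R) 0).obj X)) = ⊤)
    (i : ℤ) : HomVanishes (ModuleCat.of R (ResidueField R)) X i := by
  induction xs generalizing X s i with
  | nil =>
    have hpow : ∀ j, ∃ k, maximalIdeal R ^ k ≤
        Module.annihilator R ((homologyFunctor (ModuleCat.{u} R) j).obj X) := fun j => by
      refine Ideal.exists_pow_le_of_le_radical_of_fg (hrad.trans ?_) (IsNoetherian.noetherian _)
      rw [Ideal.ofList_nil, sup_bot_eq, Ideal.radical_le_radical_iff, Ideal.span_le]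
      exact fun a ha => (hs a ha).mem_radical_annihilator j
    -- In negative degrees the lowest homology module has no socle, yet is killed by a power of `𝔪`;
    -- so it vanishes and the lower bound rises one step at a time up to `0`.
    have hGE' : ∀ m : ℕ, ∀ c : ℤ, X.IsGE c → 0 ≤ c + m → X.IsGE 0 := by
      intro m
      induction m with
      | zero =>
        intro c hc h0
        exact TStructure.t.isGE_of_ge X 0 c (by simpa using h0)
      | succ m ih =>
        intro c hc h0
        by_cases hc0 : 0 ≤ c
        · exact TStructure.t.isGE_of_ge X 0 c hc0
        · refine ih (c + 1) ?_ (by push_cast at h0; omega)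
          rw [isGE_iff]
          intro j hj
          rcases (Int.lt_add_one_iff.1 hj).lt_or_eq with h | rfl
          · exact isZero_of_isGE X c j h
          · obtain ⟨k, hk⟩ := hpow j
            exact isZero_homology_of_homVanishes (hV j (by simpa using hc0)) hk
    obtain ⟨c, hc⟩ := hGE
    have h0 : X.IsGE 0 := hGE' (-c).toNat c hc (by omega)
    -- No vanishing is available in degree `0`; there `H^0 = 𝔪^k H^0 = 0` for large `k`.
    have h1 : X.IsGE 1 := by
      rw [isGE_iff]
      intro j hj
      rcases (Int.lt_add_one_iff.1 (by simpa using hj : j < 0 + 1)).lt_or_eq with h | rfl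
      · exact isZero_of_isGE X 0 j h
      · obtain ⟨k, hk⟩ := hpow 0
        rw [ModuleCat.isZero_iff_subsingleton, ← Submodule.subsingleton_iff R,
          ← subsingleton_iff_bot_eq_top, eq_comm]
        have hd : ∀ k, (maximalIdeal R ^ k • ⊤ :
            Submodule R ((homologyFunctor (ModuleCat.{u} R) 0).obj X)) = ⊤ := fun k => by
          induction k with
          | zero => simp
          | succ k ih => rw [pow_succ, Submodule.mul_smul, hdiv, ih]
        rw [← hd k, eq_bot_iff, Submodule.smul_le]
        exact fun a ha z _ => (Submodule.mem_bot R).2 (Module.mem_annihilator.1 (hk ha) z)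
    exact fun f => (TStructure.t.isZero X 0 1).eq_of_tgt _ _
  | cons x xs ih =>
    obtain ⟨Y, f, g, hT⟩ := distinguished_cocone_triangle (x • 𝟙 X)
    have hLE : Y.IsLE 0 := by
      have := isLE_obj₃ (n := 0) hT (h₁ := ‹_›) (h₂ := ‹_›)
      exact this
    have hsurj : Function.Surjective ((homologyFunctor (ModuleCat.{u} R) 0).map f).hom :=
      surjective_homology_mor₂ (n := 0) hT (h₁ := ‹_›)
    have hY : ∀ i, HomVanishes (ModuleCat.of R (ResidueField R)) Y i := by
      refine ih (fun y hy => hxs y (by simp [hy])) (insert x s) ?_ ?_ ?_ ?_ ?_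
      · rintro a (rfl | ha)
        · exact actsNilpotently_cone hT
        · exact (hs a ha).cone hT
      · rwa [Ideal.span_insert, sup_comm (Ideal.span {x}), sup_assoc, ← Ideal.ofList_cons]
      · obtain ⟨c, hc⟩ := hGE
        exact ⟨c - 1, isGE_obj₃ hT (h₁ := hc) (h₂ := hc)⟩
      · intro i hi
        refine HomVanishes.obj₃ hT (hV (i + 1) ?_) (hV i ?_)
        · simpa using hi
        · simp only [List.length_cons, Nat.cast_add, Nat.cast_one]
          omega
      · have := congrArg (Submodule.map
          ((homologyFunctor (ModuleCat.{u} R) 0).map f).hom) hdiv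
        rwa [Submodule.map_smul'', Submodule.map_top, LinearMap.range_eq_top.2 hsurj] at this
    obtain ⟨j, rfl⟩ : ∃ j, i = j + 1 := ⟨i - 1, by ring⟩
    -- Vanishing on the cone makes composition with `x` injective on maps from shifts of `k`, but
    -- `x` kills `k`.
    refine HomVanishes.obj₁ hT (hY j) fun (φ : _ ⟶ X) => ?_
    change φ ≫ (x • 𝟙 X) = 0
    have hx : x • 𝟙 (ModuleCat.of R (ResidueField R)) = 0 := by
      refine ModuleCat.hom_ext (LinearMap.ext fun y => ?_)
      change x • y = 0
      rw [Algebra.smul_def, ResidueField.algebraMap_eq,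
        (residue_eq_zero_iff x).2 (hxs x (by simp)), zero_mul]
    calc φ ≫ (x • 𝟙 X) = (x • 𝟙 _) ≫ φ := by
          rw [Linear.comp_smul, Linear.smul_comp, Category.comp_id, Category.id_comp]
      _ = (singleFunctor (ModuleCat.{u} R) (j + 1)).map (x • 𝟙 _) ≫ φ := by
          rw [Functor.map_smul, CategoryTheory.Functor.map_id]
      _ = 0 := by rw [hx, Functor.map_zero, Limits.zero_comp]

theorem homVanishes_single_iff {N : ModuleCat.{u} R} {i : ℕ} :
    HomVanishes (ModuleCat.of R (ResidueField R))
      ((singleFunctor (ModuleCat.{u} R) 0).obj N) i ↔ Subsingleton (ResidueExt R N i) := by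
  rw [← homVanishes_shift_iff (add_zero (i : ℤ))]
  constructor
  · intro h
    exact subsingleton_of_forall_eq 0 fun y => Abelian.Ext.homEquiv.injective
      ((h _).trans (h _).symm)
  · intro h f
    have : Subsingleton (ShiftedHom
        ((singleFunctor (ModuleCat.{u} R) 0).obj (ModuleCat.of R (ResidueField R)))
        ((singleFunctor (ModuleCat.{u} R) 0).obj N) (i : ℤ)) :=
      Abelian.Ext.homEquiv.symm.subsingleton
    exact this.elim _ _

end Koszul

/-! ### Infinite depth from `N = 𝔪 N` -/

section Width

variable {R : Type u} [CommRing R] [IsLocalRing R] [IsNoetherianRing R]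

/-- Let `N` be a module with `N = 𝔪 N`, and `xs` a sequence that generates an `𝔪`-primary ideal.
If `depth N` is at least the length of `xs`, then it is infinite. -/
theorem subsingleton_residueExt_of_smul_top_eq_top {N : Type u} [AddCommGroup N] [Module R N]
    (hN : (maximalIdeal R • ⊤ : Submodule R N) = ⊤) (xs : List R)
    (hxs : (Ideal.ofList xs).radical = maximalIdeal R)
    (h : ∀ i < xs.length, Subsingleton (ResidueExt R N i)) (i : ℕ) :
    Subsingleton (ResidueExt R N i) := by
  let : HasDerivedCategory (ModuleCat.{u} R) := HasDerivedCategory.standard _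
  let X := (DerivedCategory.singleFunctor (ModuleCat.{u} R) 0).obj (ModuleCat.of R N)
  refine homVanishes_single_iff.1 (homVanishes_of_list (X := X) xs (fun x hx => ?_) ∅ (by simp)
    (by simp [hxs]) ⟨0, inferInstance⟩ (fun i hi => ?_) ?_ i)
  · rw [← hxs]
    exact Ideal.le_radical (Ideal.subset_span hx)
  · rcases lt_or_ge i 0 with hi0 | hi0
    · exact fun f => DerivedCategory.TStructure.t.zero f i 0
    · lift i to ℕ using hi0
      exact homVanishes_single_iff.2 (h i (by exact_mod_cast hi))
  · have e : N ≃ₗ[R] ((DerivedCategory.homologyFunctor (ModuleCat.{u} R) 0).obj X) :=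
      ((DerivedCategory.singleFunctorCompHomologyFunctorIso (ModuleCat.{u} R) 0).symm.app
        (ModuleCat.of R N)).toLinearEquiv
    have := congrArg (Submodule.map e.toLinearMap) hN
    rwa [Submodule.map_smul'', Submodule.map_top, LinearEquiv.range] at this

end Width

/-! ### Modules of finite G-dimension have totally reflexive syzygies -/

section Complexes

variable {R : Type u} [CommRing R]

theorem exists_isShortExact_homology (S : ShortComplex (ModuleCat.{u} R)) {M : ModuleCat.{u} R}
    (e : S.homology ≅ M) : ∃ (f : LinearMap.range S.f.hom →ₗ[R] LinearMap.ker S.g.hom)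
      (q : LinearMap.ker S.g.hom →ₗ[R] M), IsShortExact f q := by
  let e' : (LinearMap.ker S.g.hom ⧸ LinearMap.range S.moduleCatToCycles) ≃ₗ[R] M :=
    (S.moduleCatHomologyIso.symm ≪≫ e).toLinearEquiv
  have hsub : ∀ x : LinearMap.range S.f.hom, x.1 ∈ LinearMap.ker S.g.hom := by
    rintro ⟨_, y, rfl⟩
    exact LinearMap.congr_fun (congrArg ModuleCat.Hom.hom S.zero) y
  refine ⟨(LinearMap.range S.f.hom).subtype.codRestrict _ hsub,
    e'.toLinearMap ∘ₗ (LinearMap.range S.moduleCatToCycles).mkQ,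
    fun x y hxy => Subtype.ext (congrArg (fun z : LinearMap.ker S.g.hom => z.1) hxy), fun x => ?_,
    e'.surjective.comp (Submodule.mkQ_surjective _)⟩
  rw [LinearMap.comp_apply, LinearEquiv.coe_coe, LinearEquiv.map_eq_zero_iff]
  refine (Submodule.Quotient.mk_eq_zero _).trans ⟨?_, ?_⟩
  · rintro ⟨y, rfl⟩
    exact ⟨⟨_, y, rfl⟩, rfl⟩
  · rintro ⟨⟨_, y, rfl⟩, rfl⟩
    exact ⟨y, rfl⟩

/-- A module is of finite G-dimension if it is the only homology module of a bounded complex of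
totally reflexive modules. -/
theorem exists_gDimLE_of_complex {K : CochainComplex (ModuleCat.{u} R) ℤ}
    (hK : ∀ n, IsTotallyReflexive R (K.X n)) {a b : ℤ} (ha : ∀ n < a, Subsingleton (K.X n))
    (hb : ∀ n > b, Subsingleton (K.X n)) (hE : ∀ n ≠ 0, K.ExactAt n) {M : ModuleCat.{u} R}
    (e : K.homology 0 ≅ M) : ∃ g, GDimLE g M := by
  have hex : ∀ i j k : ℤ, i + 1 = j → j + 1 = k → j ≠ 0 →
      Function.Exact (K.d i j).hom (K.d j k).hom := by
    intro i j k hij hjk hj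
    have h := (K.exactAt_iff' i j k (by simp [← hij]) (by simp [← hjk])).1 (hE j hj)
    intro x
    constructor
    · exact fun hx => (ShortComplex.moduleCat_exact_iff _).1 h x hx
    · rintro ⟨y, rfl⟩
      exact LinearMap.congr_fun (congrArg ModuleCat.Hom.hom (K.d_comp_d i j k)) y
  -- Cycles in degrees `≥ 0` are totally reflexive, by descent from the top as kernels of
  -- surjections. Boundaries coming from negative degrees only have finite G-dimension, by ascent
  -- from the bottom as cokernels. `M` is the quotient of the two in degree `0`.
  have hZ : ∀ (n : ℕ) (i j : ℤ), i + 1 = j → 0 ≤ i → b < i + n →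
      IsTotallyReflexive R (ModuleCat.of R (LinearMap.ker (K.d i j).hom)) := by
    intro n
    induction n with
    | zero =>
      intro i j hij hi hn
      have := hb i (by simpa using hn)
      refine (hK i).of_equiv (LinearEquiv.ofTop _ (Submodule.eq_top_iff'.2 fun x => ?_)).symm
      rw [Subsingleton.elim x 0]
      exact zero_mem _
    | succ n ih =>
      intro i j hij hi hn
      have hj := ih j (j + 1) rfl (by omega) (by push_cast at hn; omega)
      have hx := hex i j (j + 1) hij rfl (by omega)
      refine IsTotallyReflexive.of_isShortExact_left
        (f := (LinearMap.ker (K.d i j).hom).subtype)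
        (g := (K.d i j).hom.codRestrict (LinearMap.ker (K.d j (j + 1)).hom)
          fun x => hx.apply_apply_eq_zero x) ⟨Subtype.val_injective, fun x => ?_, fun y => ?_⟩
        (hK i) hj
      · rw [← Subtype.val_inj]
        exact ⟨fun h => ⟨⟨x, h⟩, rfl⟩, by rintro ⟨y, rfl⟩; exact y.2⟩
      · obtain ⟨x, hxy⟩ := (hx y).1 y.2
        exact ⟨x, Subtype.ext hxy⟩
  have hB : ∀ (n : ℕ) (i j : ℤ), i + 1 = j → i < 0 → i < a + n →
      ∃ g, GDimLE g (ModuleCat.of R (LinearMap.range (K.d i j).hom)) := by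
    intro n
    induction n with
    | zero =>
      intro i j hij hi hn
      have := ha i (by simpa using hn)
      have : Subsingleton (LinearMap.range (K.d i j).hom) :=
        (LinearMap.surjective_rangeRestrict _).subsingleton
      exact ⟨0, (hK i).of_equiv (LinearEquiv.ofSubsingleton _ _)⟩
    | succ n ih =>
      intro i j hij hi hn
      have h' := ih (i - 1) i (by ring) (by omega) (by push_cast at hn; omega)
      have hx := hex (i - 1) i j (by ring) hij (by omega)
      refine exists_gDimLE_of_isShortExact
        (A := ModuleCat.of R (LinearMap.range (K.d (i - 1) i).hom)) (B := K.X i)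
        (f := (LinearMap.range (K.d (i - 1) i).hom).subtype) (q := (K.d i j).hom.rangeRestrict)
        ⟨Subtype.val_injective, fun x => ?_, LinearMap.surjective_rangeRestrict _⟩ h'
        ⟨0, hK i⟩
      rw [← Subtype.val_inj]
      exact (hx x).trans (by simp)
  have hZ0 := hZ (b + 1).toNat 0 1 (by ring) le_rfl (by omega)
  have hB0 := hB (-a).toNat (-1) 0 (by ring) (by omega) (by omega)
  obtain ⟨f, q, hfq⟩ := exists_isShortExact_homology (K.sc' (-1) 0 1)
    ((ShortComplex.homologyMapIso (K.isoSc' (-1) 0 1 (by simp) (by simp))).symm ≪≫ e)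
  exact exists_gDimLE_of_isShortExact
    (A := ModuleCat.of R (LinearMap.range (K.d (-1) 0).hom))
    (B := ModuleCat.of R (LinearMap.ker (K.d 0 1).hom)) (f := f) (q := q) hfq hB0 ⟨0, hZ0⟩

theorem exists_gDimLE_of_gDim_lt_top {M : ModuleCat.{u} R} (h : gDim R M < ⊤) :
    ∃ g, GDimLE g M := by
  obtain ⟨K, ⟨hK, ⟨b, hb⟩, hKM⟩, hsup⟩ : ∃ K ∈ {K : CochainComplex (ModuleCat.{u} R) ℤ |
      (∀ n, IsTotallyReflexive R (K.X n)) ∧ (∃ n : ℤ, K.IsStrictlyLE n) ∧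
        IsoInDerivedCategory R K M},
      (⨆ l ∈ {l : ℤ | ¬ Limits.IsZero (K.X (-l))}, ((l : WithTop ℤ) : WithBot (WithTop ℤ))) ≠ ⊤ := by
    by_contra! hc
    exact h.ne (top_le_iff.1 (le_iInf₂ fun K hK => (hc K hK).ge))
  obtain ⟨L, hL⟩ : ∃ L : ℤ, ∀ l : ℤ, ¬ Limits.IsZero (K.X (-l)) → l ≤ L := by
    have hle : ∀ l : ℤ, ¬ Limits.IsZero (K.X (-l)) → ((l : WithTop ℤ) : WithBot (WithTop ℤ)) ≤ _ :=
      fun l hl => le_iSup₂ (f := fun (l : ℤ) (_ : l ∈ {l : ℤ | ¬ Limits.IsZero (K.X (-l))}) =>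
        ((l : WithTop ℤ) : WithBot (WithTop ℤ))) l hl
    generalize (⨆ l ∈ {l : ℤ | ¬ Limits.IsZero (K.X (-l))},
      ((l : WithTop ℤ) : WithBot (WithTop ℤ))) = t at hle hsup
    induction t with
    -- The value `⊥` means that no term of the complex is nonzero, so any bound serves.
    | bot => exact ⟨0, fun l hl => absurd (hle l hl) (by simp)⟩
    | coe t =>
      induction t with
      | top => exact absurd rfl hsup
      | coe t => exact ⟨t, fun l hl => by exact_mod_cast hle l hl⟩
  let : HasDerivedCategory (ModuleCat.{u} R) := HasDerivedCategory.standard _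
  obtain ⟨e⟩ : Nonempty (DerivedCategory.Q.obj K ≅
    (DerivedCategory.singleFunctor (ModuleCat.{u} R) 0).obj M) := hKM
  let e' (n : ℤ) : K.homology n ≅ (DerivedCategory.homologyFunctor (ModuleCat.{u} R) n).obj
      ((DerivedCategory.singleFunctor (ModuleCat.{u} R) 0).obj M) :=
    ((DerivedCategory.homologyFunctorFactors (ModuleCat.{u} R) n).app K).symm ≪≫
      (DerivedCategory.homologyFunctor (ModuleCat.{u} R) n).mapIso e
  refine exists_gDimLE_of_complex hK (a := -L) (b := b) (fun n hn => ?_) (fun n hn => ?_)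
    (fun n hn => ?_) (e' 0 ≪≫
      (DerivedCategory.singleFunctorCompHomologyFunctorIso (ModuleCat.{u} R) 0).app M)
  · rw [← ModuleCat.isZero_iff_subsingleton]
    by_contra hc
    have := hL (-n) (by rwa [neg_neg])
    omega
  · rw [← ModuleCat.isZero_iff_subsingleton]
    exact K.isZero_of_isStrictlyLE b n hn
  · rw [HomologicalComplex.exactAt_iff_isZero_homology]
    refine Limits.IsZero.of_iso ?_ (e' n)
    rcases lt_or_gt_of_ne hn with h | h
    · exact DerivedCategory.isZero_of_isGE _ 0 n h
    · exact DerivedCategory.isZero_of_isLE _ 0 n h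

end Complexes

/-! ### Vanishing of `Tor` -/

section Tor

variable {R : Type u} [CommRing R]

/-- Comparison with the resolution presents `N` as the cokernel of `(θ, -d₁) : P₁ → K × P₀`. An
element `z` of `B ⊗ K` dying in `B ⊗ N` is thus the image under `θ` of a cycle of `B ⊗ P₁`; that
cycle comes from `B ⊗ P₂`, and `θ ∘ d₂ = 0`. -/
theorem IsShortExact.injective_lTensor_of_exact {P₂ P₁ P₀ K N T : Type u}
    [AddCommGroup P₂] [Module R P₂] [AddCommGroup P₁] [Module R P₁] [AddCommGroup P₀] [Module R P₀]
    [AddCommGroup K] [Module R K] [AddCommGroup N] [Module R N] [AddCommGroup T] [Module R T]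
    {i : K →ₗ[R] N} {p : N →ₗ[R] T} (h : IsShortExact i p) {d₂ : P₂ →ₗ[R] P₁} {d₁ : P₁ →ₗ[R] P₀}
    {ε : P₀ →ₗ[R] T} (hd : ∀ x, d₁ (d₂ x) = 0) (hε : Function.Exact d₁ ε)
    (hε' : Function.Surjective ε) [Module.Projective R P₀] {B : Type u} [AddCommGroup B]
    [Module R B] (hB : Function.Exact (d₂.lTensor B) (d₁.lTensor B)) : Function.Injective (i.lTensor B) := by
  obtain ⟨s, hs⟩ := Module.projective_lifting_property p ε h.surjective
  have hs' : ∀ x, p (s x) = ε x := LinearMap.congr_fun hs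
  obtain ⟨θ, hθ⟩ := exists_comp_eq_of_injective h.injective (s ∘ₗ d₁) fun x =>
    (h.exact _).1 (by simp [hs', hε.apply_apply_eq_zero])
  have hθd : θ ∘ₗ d₂ = 0 := LinearMap.ext fun x => h.injective (by simp [hθ, hd])
  have hex : Function.Exact (θ.prod (-d₁)) (i.coprod s) := by
    rintro ⟨k, x⟩
    constructor
    · intro hkx
      rw [LinearMap.coprod_apply] at hkx
      have hx : ε x = 0 := by
        simpa [h.comp_apply, hs'] using congrArg p hkx
      obtain ⟨y, rfl⟩ := (hε x).1 hx
      refine ⟨-y, Prod.ext (h.injective ?_) (by simp)⟩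
      have := hθ y
      simp only [LinearMap.comp_apply] at this
      simp [this, eq_neg_of_add_eq_zero_left hkx]
    · rintro ⟨y, hy⟩
      rw [← hy]
      simp [hθ]
  have hsurj : Function.Surjective (i.coprod s) := fun y => by
    obtain ⟨x, hx⟩ := hε' (p y)
    obtain ⟨k, hk⟩ := (h.exact (y - s x)).1 (by rw [map_sub, hs', hx, sub_self])
    exact ⟨(k, x), by simp [hk]⟩
  rw [injective_iff_map_eq_zero]
  intro z hz
  have hz' : (i.coprod s).lTensor B ((LinearMap.inl R K P₀).lTensor B z) = 0 := by
    rw [← LinearMap.comp_apply, ← LinearMap.lTensor_comp, LinearMap.coprod_inl, hz]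
  obtain ⟨w, hw⟩ := (lTensor_exact B hex hsurj _).1 hz'
  have h1 : θ.lTensor B w = z := by
    have := congrArg ((LinearMap.fst R K P₀).lTensor B) hw
    simpa only [← LinearMap.comp_apply, ← LinearMap.lTensor_comp, LinearMap.fst_prod,
      LinearMap.fst_comp_inl, LinearMap.lTensor_id, LinearMap.id_apply] using this
  have h2 : d₁.lTensor B w = 0 := by
    have := congrArg ((LinearMap.snd R K P₀).lTensor B) hw
    simpa only [← LinearMap.comp_apply, ← LinearMap.lTensor_comp, LinearMap.snd_prod,
      LinearMap.snd_comp_inl, LinearMap.lTensor_zero, LinearMap.zero_apply, LinearMap.lTensor_neg,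
      LinearMap.neg_apply, neg_eq_zero] using this
  obtain ⟨v, rfl⟩ := (hB w).1 h2
  rw [← h1, ← LinearMap.comp_apply, ← LinearMap.lTensor_comp, hθd, LinearMap.lTensor_zero,
    LinearMap.zero_apply]

theorem isZero_tor_one_iff (B : ModuleCat.{u} R) {T : ModuleCat.{u} R}
    (P : ProjectiveResolution T) : Limits.IsZero (((Tor (ModuleCat.{u} R) 1).obj B).obj T) ↔
      Function.Exact ((P.complex.d 2 1).hom.lTensor B) ((P.complex.d 1 0).hom.lTensor B) := by
  let F := (MonoidalCategory.tensoringLeft (ModuleCat.{u} R)).obj B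
  let C := (F.mapHomologicalComplex _).obj P.complex
  have h1 : Limits.IsZero (((Tor (ModuleCat.{u} R) 1).obj B).obj T) ↔ C.ExactAt 1 :=
    (P.isoLeftDerivedObj F 1).isZero_iff.trans (C.exactAt_iff_isZero_homology 1).symm
  rw [h1, C.exactAt_iff' 2 1 0 (by simp) (by simp)]
  refine (ShortComplex.ShortExact.moduleCat_exact_iff_function_exact _).trans Iff.rfl

theorem IsShortExact.injective_lTensor_of_isZero_tor {B T : ModuleCat.{u} R}
    (hT : Limits.IsZero (((Tor (ModuleCat.{u} R) 1).obj B).obj T)) {K N : Type u}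
    [AddCommGroup K] [Module R K] [AddCommGroup N] [Module R N] {i : K →ₗ[R] N} {p : N →ₗ[R] T}
    (h : IsShortExact i p) : Function.Injective (i.lTensor B) := by
  let P := projectiveResolution T
  have : Module.Projective R (P.complex.X 0) :=
    (IsProjective.iff_projective _).2 (P.projective 0)
  refine h.injective_lTensor_of_exact (ε := (P.π.f 0).hom)
    (fun x => LinearMap.congr_fun (congrArg ModuleCat.Hom.hom (P.complex.d_comp_d 2 1 0)) x) ?_
    ((ModuleCat.epi_iff_surjective _).1 inferInstance) ((isZero_tor_one_iff B P).1 hT)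
  exact (ShortComplex.ShortExact.moduleCat_exact_iff_function_exact _).1 P.exact₀

theorem isZero_tor_one_self (T : ModuleCat.{u} R) :
    Limits.IsZero (((Tor (ModuleCat.{u} R) 1).obj (ModuleCat.of R R)).obj T) := by
  rw [isZero_tor_one_iff _ (projectiveResolution T)]
  refine Module.Flat.lTensor_exact R ?_
  exact (ShortComplex.ShortExact.moduleCat_exact_iff_function_exact _).1
    ((projectiveResolution T).exact_succ 0)

end Tor

/-! ### Big Cohen–Macaulay modules and totally reflexive modules -/

section Main

open RingTheory.Sequence

variable {R : Type u} [CommRing R] [IsLocalRing R]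

theorem ofList_le_maximalIdeal {xs : List R} (h : ∀ x ∈ xs, x ∈ maximalIdeal R) :
    Ideal.ofList xs ≤ maximalIdeal R :=
  Ideal.span_le.2 h

theorem IsSystemOfParameters.mem_maximalIdeal {xs : List R} (h : IsSystemOfParameters R xs) :
    ∀ x ∈ xs, x ∈ maximalIdeal R := fun _ hx =>
  h.2 ▸ Ideal.le_radical (Ideal.subset_span hx)

theorem IsSystemOfParameters.le_depth_tensor {B : ModuleCat.{u} R} {xs : List R}
    (hxs : IsSystemOfParameters R xs) (hB : IsRegular B xs)
    (hT : ∀ T : ModuleCat.{u} R, IsTotallyReflexive R T →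
      Limits.IsZero (((Tor (ModuleCat.{u} R) 1).obj B).obj T))
    {T : ModuleCat.{u} R} (h : IsTotallyReflexive R T) :
    ringKrullDim R ≤ (depth R (ModuleCat.of R (B ⊗[R] T)) : WithBot ℕ∞) := by
  have := (le_depth_iff (M := ModuleCat.of R (B ⊗[R] T)) (n := xs.length)).2
    (h.subsingleton_residueExt_tensor (N := B)
      (fun _ T' _ _ _ hT' hp => hp.injective_lTensor_of_isZero_tor (hT T' hT'))
      (forall_subsingleton_of_isWeaklyRegular hxs.mem_maximalIdeal hB.toIsWeaklyRegular))
  rw [← hxs.1]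
  exact_mod_cast this

variable [IsNoetherianRing R]

variable (R) in
-- The maximal ideal is minimal over an ideal generated by as many elements as its height.
theorem exists_isSystemOfParameters : ∃ xs : List R, IsSystemOfParameters R xs := by
  obtain ⟨s, hs, hc⟩ := (maximalIdeal R).exists_finset_card_eq_height_of_isNoetherianRing
  have hs' : Ideal.ofList s.toList = Ideal.span s := by simp [Ideal.ofList]
  refine ⟨s.toList, ?_, le_antisymm ?_ ?_⟩
  · rw [Finset.length_toList, ← maximalIdeal_height_eq_ringKrullDim, ← hc]
    rfl
  · rw [hs']
    exact (Ideal.IsPrime.radical_le_iff inferInstance).2 hs.1.2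
  · rw [hs', Ideal.radical_eq_sInf]
    exact le_sInf fun p hp => hs.2 ⟨hp.2, hp.1⟩ (le_maximalIdeal hp.2.ne_top)

theorem isSystemOfParameters_of_isRegular {xs : List R} (hm : ∀ x ∈ xs, x ∈ maximalIdeal R)
    (hx : IsRegular R xs) (h : (xs.length : WithBot ℕ∞) = ringKrullDim R) :
    IsSystemOfParameters R xs := by
  refine ⟨h, le_antisymm ((Ideal.IsPrime.radical_le_iff inferInstance).2
    (ofList_le_maximalIdeal hm)) (maximalIdeal_le_radical_of_ringKrullDim_le_zero ?_)⟩
  have := ringKrullDim_add_length_eq_ringKrullDim_of_isRegular xs hx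
  rw [← h] at this
  have h0 : ringKrullDim (R ⧸ Ideal.ofList xs) + xs.length = 0 + xs.length := by
    rw [this, zero_add]
  exact (ENat.WithBot.add_natCast_cancel.1 h0).le

/-- A local ring is Cohen–Macaulay if and only if `Ext^i(k, R)` vanishes for `i < dim R`. -/
theorem isCohenMacaulayLocalRing_iff {n : ℕ} (hn : ringKrullDim R = n) :
    IsCohenMacaulayLocalRing R ↔ ∀ i < n, Subsingleton (ResidueExt R R i) := by
  have hs : Module.supportDim R (ModuleCat.of R R) = n :=
    (Module.supportDim_self_eq_ringKrullDim (R := R)).trans hn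
  have hnt : ¬ Subsingleton (ModuleCat.of R R) := not_subsingleton R
  rw [IsCohenMacaulayLocalRing, IsCohenMacaulayModule, hs, or_iff_right hnt]
  refine ⟨fun h => ?_, fun h => ⟨inferInstanceAs (Module.Finite R R), ?_⟩⟩
  · have h' : depth R (ModuleCat.of R R) = n := by exact_mod_cast h.2
    exact le_depth_iff.1 h'.ge
  · suffices depth R (ModuleCat.of R R) = n by rw [this]; rfl
    refine le_antisymm ?_ (le_depth_iff.2 h)
    by_contra! hc
    have hc' : ((n + 1 : ℕ) : ℕ∞) ≤ depth R (ModuleCat.of R R) := by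
      push_cast
      exact Order.add_one_le_of_lt hc
    -- A regular sequence longer than `dim R` would leave a nonzero quotient of negative dimension.
    obtain ⟨xs, hl, -, hx⟩ := exists_isRegular_of_forall_subsingleton (n + 1) (N := R)
      (le_depth_iff.1 hc')
    have hd := ringKrullDim_add_length_eq_ringKrullDim_of_isRegular xs hx
    have : Nontrivial (R ⧸ Ideal.ofList xs) := Ideal.Quotient.nontrivial_iff.2 fun ht =>
      hx.top_ne_smul (by simp [ht])
    have h0 : (0 : WithBot ℕ∞) ≤ ringKrullDim (R ⧸ Ideal.ofList xs) :=
      ringKrullDim_nonneg_of_nontrivial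
    rw [hn, hl] at hd
    have h1 : ((n + 1 : ℕ) : WithBot ℕ∞) ≤ n := by
      rw [← hd]
      exact le_add_of_nonneg_left h0
    have : n + 1 ≤ n := by exact_mod_cast h1
    omega

/-- `B/(x)B` is nonzero and killed by a power of `𝔪`, so it has a nonzero socle and cannot inherit
infinite depth. -/
theorem depth_lt_top_of_isBigCohenMacaulay {B : ModuleCat.{u} R} (hB : IsBigCohenMacaulay R B) :
    depth R B < ⊤ := by
  obtain ⟨xs, hxs, hB⟩ := hB
  rw [depth_lt_top_iff]
  by_contra! hc
  obtain ⟨K, hK⟩ := Ideal.exists_pow_le_of_le_radical_of_fg hxs.2.ge (IsNoetherian.noetherian _)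
  have := subsingleton_of_pow_maximalIdeal_le_annihilator
    (forall_subsingleton_quotient_of_isWeaklyRegular hB.toIsWeaklyRegular hc 0) (K := K)
    fun a ha => Module.mem_annihilator.2 fun z => by
      obtain ⟨z, rfl⟩ := Submodule.Quotient.mk_surjective _ z
      rw [← Submodule.Quotient.mk_smul, Submodule.Quotient.mk_eq_zero]
      exact Submodule.smul_mem_smul (hK ha) trivial
  exact hB.top_ne_smul (Submodule.Quotient.subsingleton_iff.1 this).symm

theorem exists_dim_zero_of_isCohenMacaulayModule {M : ModuleCat.{u} R} [Nontrivial M]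
    (hM : IsCohenMacaulayModule R M) (hg : gDim R M < ⊤) :
    ∃ N : ModuleCat.{u} R, Module.Finite R N ∧ Nontrivial N ∧ (∃ g, GDimLE g N) ∧
      ∃ K, maximalIdeal R ^ K ≤ Module.annihilator R N := by
  obtain ⟨hfin, hd⟩ := hM
  replace hd := hd.resolve_left (not_subsingleton M)
  obtain ⟨xs, hxs, -⟩ := exists_isSystemOfParameters R
  have hle : (depth R M : WithBot ℕ∞) ≤ xs.length := by
    rw [hd, hxs]
    exact Module.supportDim_le_ringKrullDim R M
  have hle' : depth R M ≤ xs.length := by exact_mod_cast hle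
  obtain ⟨d, hd'⟩ := ENat.ne_top_iff_exists.1 (ne_top_of_le_ne_top (ENat.natCast_ne_top _) hle')
  refine exists_dim_zero_of_supportDim_eq d (le_depth_iff.1 hd'.le) ?_
    (exists_gDimLE_of_gDim_lt_top hg)
  rw [← hd, ← hd']
  rfl

theorem isCohenMacaulayLocalRing_of_le_depth_tensor {B : ModuleCat.{u} R} (hB : depth R B < ⊤)
    (hT : ∀ T : ModuleCat.{u} R, IsTotallyReflexive R T →
      ringKrullDim R ≤ (depth R (ModuleCat.of R (B ⊗[R] T)) : WithBot ℕ∞))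
    {M : ModuleCat.{u} R} [Module.Finite R M] [Nontrivial M] (hM : ∃ g, GDimLE g M) {K : ℕ}
    (hK : maximalIdeal R ^ K ≤ Module.annihilator R M) : IsCohenMacaulayLocalRing R := by
  classical
  obtain ⟨xs, hxs, hrad⟩ := exists_isSystemOfParameters R
  have hT' : ∀ T : ModuleCat.{u} R, IsTotallyReflexive R T → ∀ i < xs.length,
      Subsingleton (ResidueExt R (B ⊗[R] T) i) := fun T h => by
    have := hT T h
    rw [← hxs] at this
    exact (le_depth_iff (M := ModuleCat.of R (B ⊗[R] T))).1 (by exact_mod_cast this)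
  -- The case `T = R` gives `depth B ≥ dim R`; with `B = 𝔪B` this would make `depth B` infinite.
  have hmB : (maximalIdeal R • ⊤ : Submodule R B) ≠ ⊤ := fun hc => by
    obtain ⟨i, hi⟩ := depth_lt_top_iff.1 hB
    exact not_subsingleton _ (subsingleton_residueExt_of_smul_top_eq_top hc xs hrad
      (fun i hi => subsingleton_residueExt_of_equiv (TensorProduct.rid R B)
        (hT' (ModuleCat.of R R) isTotallyReflexive_of_free i hi)) i)
  rw [isCohenMacaulayLocalRing_iff hxs.symm]
  by_contra! hc
  -- The least degree where `Ext(k, R)` survives is `depth R`, here assumed smaller than `dim R`.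
  obtain ⟨hlt, hnt⟩ := Nat.find_spec hc
  obtain ⟨g, hg, hMg⟩ := exists_gDimLE_le_depth (r := Nat.find hc)
    (fun i hi => by
      by_contra hs
      exact Nat.find_min hc hi ⟨hi.trans hlt, not_subsingleton_iff_nontrivial.1 hs⟩) hnt hM
  have := hMg.le_of_subsingleton_residueExt_tensor hT' hmB hK
  omega

end Main

end LocalAlgebra

end

theorem theorem4p3 (R : Type u) [CommRing R] [IsNoetherianRing R] [IsLocalRing R]
    (hM : ∃ M : ModuleCat.{u} R, Nontrivial M ∧ LocalAlgebra.IsCohenMacaulayModule R M ∧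
      LocalAlgebra.gDim R M < ⊤) :
    List.TFAE [
      LocalAlgebra.IsCohenMacaulayLocalRing R,
      ∃ B : ModuleCat.{u} R, LocalAlgebra.IsBigCohenMacaulay R B ∧
        ∀ T : ModuleCat.{u} R, LocalAlgebra.IsTotallyReflexive R T →
          Limits.IsZero (((Tor (ModuleCat.{u} R) 1).obj B).obj T),
      ∃ B : ModuleCat.{u} R, LocalAlgebra.depth R B < ⊤ ∧
        ∀ T : ModuleCat.{u} R, LocalAlgebra.IsTotallyReflexive R T →
          ringKrullDim R ≤ (LocalAlgebra.depth R (ModuleCat.of R (B ⊗[R] T)) : WithBot ℕ∞)] := by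
  open LocalAlgebra in
  tfae_have 1 → 2 := by
    intro h
    obtain ⟨ys, hys, -⟩ := exists_isSystemOfParameters R
    obtain ⟨xs, hl, hm, hx⟩ := exists_isRegular_of_forall_subsingleton ys.length
      ((isCohenMacaulayLocalRing_iff hys.symm).1 h)
    exact ⟨ModuleCat.of R R, ⟨xs, isSystemOfParameters_of_isRegular hm hx (by rw [hl, hys]), hx⟩,
      fun T _ => isZero_tor_one_self T⟩
  tfae_have 2 → 3 := by
    rintro ⟨B, hB, hT⟩
    refine ⟨B, LocalAlgebra.depth_lt_top_of_isBigCohenMacaulay hB, fun T h => ?_⟩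
    obtain ⟨xs, hxs, hx⟩ := hB
    exact hxs.le_depth_tensor hx hT h
  tfae_have 3 → 1 := by
    rintro ⟨B, hB, hT⟩
    obtain ⟨M, hnt, hCM, hg⟩ := hM
    obtain ⟨N, hfin, hnt', hN, K, hK⟩ :=
      LocalAlgebra.exists_dim_zero_of_isCohenMacaulayModule hCM hg
    exact LocalAlgebra.isCohenMacaulayLocalRing_of_le_depth_tensor hB hT hN hK
  tfae_finish
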